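/- Let $k$ be a commutative ring and $\Lambda$ an abelian group. A Jordan triple system $J$ over $k$ is a $k$-module with a quadratic map $P:J\to\operatorname{End}_k(J)$ and $\{x\,y\,z\}=P(x,z)y=(P(x+z)-P(x)-P(z))y$, such that $\{x,y,P(x)z\}=P(x)\{y,x,z\}$, $\{P(x)y,y,z\}=\{x,P(y)x,z\}$, $P(P(x)y)=P(x)P(y)P(x)$ hold in all scalar extensions. It is graded by $\Lambda$ if $J=\bigoplus_{\lambda\in\Lambda}J^\lambda$ with $P(J^\lambda)J^\mu\subseteq J^{2\lambda+\mu}$ and $\{J^\lambda,J^\mu,J^\nu\}\subseteq J^{\lambda+\mu+\nu}$. For a tripotent $e$ ($P(e)e=e$) with Peirce spaces $J_2(e)=P(e)J$, $J_1(e)=\{x:\{e\,e\,x\}=x\}$, $J_0(e)=\{x:\{e\,e\,x\}=0=P(e)x\}$, a triangle $(u;e_1,e_2)$ consists of nonzero tripotents with $e_i\in J_0(e_j)$ ($i\ne j$), $e_i\in J_2(u)$, $u\in J_1(e_1)\cap J_1(e_2)$, $P(u)e_i=e_j$ ($i\neq j$) and $P(e_1,e_2)u=u$. Let $J$ be a Jordan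 triple system graded by $\Lambda$, which is graded-triangulated by a triangle $(u;e_1,e_2)$, i.e. $u,e_1,e_2\in J^0$ and $J=J_1\oplus M\oplus J_2$ with $J_i=J_2(e_i)$ and $M=J_1(e_1)\cap J_1(e_2)$. Assume the triangulation is faithful: $x_1\in J_1$ and $\{x_1\,e_1\,u\}=0$ imply $x_1=0$. Put $e=e_1+e_2$, $L(x_1)m=\{x_1\,e_1\,m\}$ for $x_1\in J_1$, $m\in M$ (so $L(x_1)\in\operatorname{End}_k(M)$), $x_2^*=P(e)P(u)x_2\in J_1$ for $x_2\in J_2$, $C_0=L(J_1)$, let $C$ be the subalgebra of $\operatorname{End}_k(M)$ generated by $C_0$, and $C^\lambda=\{c\in C: cM^\mu\subseteq M^{\mu+\lambda}\text{ for all }\mu\}$, where $M^\mu=M\cap J^\mu$. Then: 1. $J_h=J_1\oplus Cu\oplus J_2$ is a graded subsystem of $J$, i.e. $P(J_h)J_h\subseteq J_h$ and $J_h=\bigoplus_\lambda (J_h\cap J^\lambda)$, and it is graded-triangulated by $(u;e_1,e_2)$. 2. $C$ has a reversal involution, i.e. a $k$-linear map $\pi:C\to C$ with $(L(x_1)\cdots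 L(x_n))^\pi=L(x_n)\cdots L(x_1)$ for all $x_1,\dots,x_n\in J_1$. Let $A=C|_{Cu}\subseteq\operatorname{End}_k(Cu)$ be the algebra of restrictions of elements of $C$ to $Cu$, $A_0=C_0|_{Cu}$ and $A^\lambda=C^\lambda|_{Cu}$. Then $(c|_{Cu})^\pi=c^\pi|_{Cu}$ and $\overline{c|_{Cu}}=P(e)\circ c\circ P(e)|_{Cu}$ are well defined on $A$ and make $(A,A_0,\pi,{}^-)$ a coordinate system graded by $\Lambda$: $A=\bigoplus_\lambda A^\lambda$ is a graded unital associative algebra, $\pi$ is an involution and $^-$ an automorphism of period $2$ of $A$, commuting and homogeneous of degree $0$; $A_0=\bigoplus_\lambda(A_0\cap A^\lambda)$, $\overline{A_0}=A_0$, $1\in A_0$, $a_0^\pi=a_0$ and $aa_0a^\pi\in A_0$ for $a\in A$, $a_0\in A_0$. It is diagonal: $A_0$ generates the algebra $A$. 3. Let $\mathrm H=\mathrm H_2(A,A_0,\pi,{}^-)$ be the Jordan triple system of hermitian ($X=X^{\pi t}$) $2\times2$ matrices over $A$ with diagonal entries in $A_0$ and product $P(X)Y=X\overline YX$, graded by letting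 $\mathrm H^\lambda$ be the set of matrices in $\mathrm H$ with entries in $A^\lambda$. Then $$x_1\oplus cu\oplus x_2\longmapsto\begin{pmatrix}L(x_1)|_{Cu}&c|_{Cu}\\ c^\pi|_{Cu}&L(x_2^*)|_{Cu}\end{pmatrix}\qquad(x_1\in J_1,\ c\in C,\ x_2\in J_2)$$ is a well-defined isomorphism of graded Jordan triple systems $J_h\to\mathrm H$ (bijective, linear, compatible with $P$ and homogeneous of degree $0$). It maps $u,e_1,e_2$ to $E_{12}+E_{21},\ E_{11},\ E_{22}$ respectively. 4. $J=J_h$ if and only if $M=Cu$. -/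

import Mathlib

/-! ### Direct sums, Jordan triple systems -/

/-- The module is the direct sum of the family of submodules `N`
(for decidable index types this is `DirectSum.IsInternal N`). -/
def IsDirectSumOf {k M ι : Type*} [CommRing k] [AddCommGroup M] [Module k M]
    (N : ι → Submodule k M) : Prop :=
  iSupIndep N ∧ ⨆ i, N i = ⊤

/-- The triple product `{x y z} = P(x,z)y` of a quadratic map `P : J → End_k(J)`, where
`P(x,z) = P(x+z) - P(x) - P(z)`. -/
def tripleOf {k J : Type*} [CommRing k] [AddCommGroup J] [Module k J]
    (P : QuadraticMap k J (Module.End k J)) (x y z : J) : J :=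
  QuadraticMap.polar P x z y

/-- A (quadratic) Jordan triple system over `k`: a quadratic map `P : J → End_k(J)` such that the
identities
* `{x, y, P(x)z} = P(x){y, x, z}`,
* `{P(x)y, y, z} = {x, P(y)x, z}`,
* `P(P(x)y) = P(x)P(y)P(x)`

hold in all scalar extensions.  The latter means that all their linearizations hold in `J`.  The
second identity is quadratic in `x` and in `y`, so its linearizations are automatic; for the first
identity (cubic in `x`) one needs in addition the component of degree `(2,1)`, and for the third
(quartic in `x`) those of degree `(3,1)` and `(2,2)`; the remaining ones are polarizations
of these. -/
structure JordanTripleSystem (k J : Type*) [CommRing k] [AddCommGroup J] [Module k J] where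
  /-- the quadratic operator -/
  P : QuadraticMap k J (Module.End k J)
  jp1 : ∀ x y z : J, tripleOf P x y (P x z) = P x (tripleOf P y x z)
  jp1_lin : ∀ x w y z : J,
    tripleOf P w y (P x z) + tripleOf P x y (tripleOf P x z w) =
      P x (tripleOf P y w z) + tripleOf P x (tripleOf P y x z) w
  jp2 : ∀ x y z : J, tripleOf P (P x y) y z = tripleOf P x (P y x) z
  jp3 : ∀ x y z : J, P (P x y) z = P x (P y (P x z))
  jp3_lin31 : ∀ x w y z : J,
    tripleOf P (P x y) z (tripleOf P x y w) =
      tripleOf P x (P y (P x z)) w + P x (P y (tripleOf P x z w))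
  jp3_lin22 : ∀ x w y z : J,
    P (tripleOf P x y w) z + tripleOf P (P x y) z (P w y) =
      P w (P y (P x z)) + P x (P y (P w z)) +
        tripleOf P x (P y (tripleOf P x z w)) w

namespace JordanTripleSystem

variable {k J : Type*} [CommRing k] [AddCommGroup J] [Module k J]

/-- The triple product `{x y z}`. -/
def tri (T : JordanTripleSystem k J) (x y z : J) : J := tripleOf T.P x y z

section identities

variable (T : JordanTripleSystem k J)

lemma tri_def (x y z : J) : T.tri x y z = T.P (x + z) y - T.P x y - T.P z y := rfl

lemma tri_comm (x y z : J) : T.tri x y z = T.tri z y x := by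
  simp only [tri, tripleOf, QuadraticMap.polar_comm]

lemma tri_add_left (x x' y z : J) : T.tri (x + x') y z = T.tri x y z + T.tri x' y z := by
  simp [tri, tripleOf, QuadraticMap.polar_add_left]

lemma tri_smul_left (a : k) (x y z : J) : T.tri (a • x) y z = a • T.tri x y z := by
  simp [tri, tripleOf, QuadraticMap.polar_smul_left]

lemma tri_add_mid (x y y' z : J) : T.tri x (y + y') z = T.tri x y z + T.tri x y' z := by
  simp [tri, tripleOf]

lemma tri_smul_mid (a : k) (x y z : J) : T.tri x (a • y) z = a • T.tri x y z := by
  simp [tri, tripleOf]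

lemma tri_add_right (x y z z' : J) : T.tri x y (z + z') = T.tri x y z + T.tri x y z' := by
  simp [tri, tripleOf, QuadraticMap.polar_add_right]

lemma tri_smul_right (a : k) (x y z : J) : T.tri x y (a • z) = a • T.tri x y z := by
  simp [tri, tripleOf, QuadraticMap.polar_smul_right]

lemma tri_zero_left (y z : J) : T.tri 0 y z = 0 := by
  simpa using T.tri_smul_left (0 : k) 0 y z

lemma tri_zero_mid (x z : J) : T.tri x 0 z = 0 := by
  simpa using T.tri_smul_mid (0 : k) x 0 z

lemma tri_zero_right (x y : J) : T.tri x y 0 = 0 := by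
  simpa using T.tri_smul_right (0 : k) x y 0

lemma P_add (x w y : J) : T.P (x + w) y = T.P x y + T.tri x y w + T.P w y := by
  rw [tri_def]; abel

lemma tri_self (x y : J) : T.tri x y x = T.P x y + T.P x y := by
  have h := QuadraticMap.polar_self T.P x
  have := congrArg (fun f : Module.End k J => f y) h
  simpa only [tri, tripleOf, two_smul, LinearMap.add_apply] using this

lemma jp7 (x y v z : J) :
    T.tri (T.P x y) v z + T.tri (T.P x v) y z = T.tri x (T.tri y x v) z := by
  have h := T.jp2 x (y + v) z
  have h1 := T.jp2 x y z
  have h2 := T.jp2 x v z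
  change T.tri _ _ _ = T.tri _ _ _ at h h1 h2
  rw [map_add, P_add] at h
  simp only [tri_add_left, tri_add_mid] at h
  rw [h1, h2] at h
  have : T.tri (T.P x y) v z + T.tri (T.P x v) y z
      = (T.tri x (T.P y x) z + T.tri (T.P x v) y z +
        (T.tri (T.P x y) v z + T.tri x (T.P v x) z))
        - T.tri x (T.P y x) z - T.tri x (T.P v x) z := by abel
  rw [this, h]; abel

lemma jp8 (x w y z : J) :
    T.tri (T.tri x y w) y z = T.tri x (T.P y w) z + T.tri w (T.P y x) z := by
  have h := T.jp2 (x + w) y z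
  have h1 := T.jp2 x y z
  have h2 := T.jp2 w y z
  change T.tri _ _ _ = T.tri _ _ _ at h h1 h2
  rw [P_add, map_add] at h
  simp only [tri_add_left, tri_add_mid] at h
  rw [h1, h2] at h
  have : T.tri (T.tri x y w) y z
      = (T.tri x (T.P y x) z + T.tri (T.tri x y w) y z + T.tri w (T.P y w) z)
        - T.tri x (T.P y x) z - T.tri w (T.P y w) z := by abel
  rw [this, h]; abel

lemma tri_P (a b x z : J) :
    T.tri a b (T.P x z) + T.P x (T.tri b a z) = T.tri (T.tri a b x) z x := by
  have h1 := T.jp1_lin x a z b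
  change T.tri _ _ _ + T.tri _ _ (T.tri _ _ _) =
    T.P _ (T.tri _ _ _) + T.tri _ (T.tri _ _ _) _ at h1
  have h3 := T.jp7 x z b a
  rw [T.tri_comm _ b a, T.tri_comm _ z a] at h3
  rw [T.tri_comm z a b, T.tri_comm x b a, T.tri_comm x z (T.tri a b x)] at h1
  have e : _ - _ = _ - _ := congrArg₂ (fun s t => s - t) h3 h1
  have : T.tri a b (T.P x z) + T.P x (T.tri b a z) =
    (T.tri a b (T.P x z) + T.tri a z (T.P x b) -
      (T.tri a z (T.P x b) + T.tri (T.tri a b x) z x)) +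
      (T.P x (T.tri b a z) + T.tri (T.tri a b x) z x) := by abel
  rw [this, ← sub_eq_zero]
  rw [← sub_eq_zero] at e
  rw [← e]; abel

/-- `{a, b, -}` acts as a derivation, up to sign and exchange in the middle variable. -/
lemma tri_tri (a b x y z : J) :
    T.tri a b (T.tri x y z) + T.tri x (T.tri b a y) z =
      T.tri (T.tri a b x) y z + T.tri x y (T.tri a b z) := by
  have h := T.tri_P a b (x + z) y
  have h1 := T.tri_P a b x y
  have h2 := T.tri_P a b z y
  simp only [P_add, tri_add_left, tri_add_right] at h
  rw [T.tri_comm x y (T.tri a b z)]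
  have : T.tri a b (T.tri x y z) + T.tri x (T.tri b a y) z =
    (T.tri a b (T.P x y) + T.tri a b (T.tri x y z) + T.tri a b (T.P z y) +
      (T.P x (T.tri b a y) + T.tri x (T.tri b a y) z + T.P z (T.tri b a y)))
    - (T.tri a b (T.P x y) + T.P x (T.tri b a y))
    - (T.tri a b (T.P z y) + T.P z (T.tri b a y)) := by abel
  rw [this, h, h1, h2]; abel

end identities

/-! ### Subsystems, gradings, isomorphisms -/

/-- A submodule is a subsystem if it is closed under `P(x)y` (and hence under `{x y z}`). -/
def IsSubsystem (T : JordanTripleSystem k J) (S : Submodule k J) : Prop :=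
  ∀ x ∈ S, ∀ y ∈ S, T.P x y ∈ S

lemma IsSubsystem.tri_mem {T : JordanTripleSystem k J} {S : Submodule k J}
    (h : T.IsSubsystem S) {x y z : J} (hx : x ∈ S) (hy : y ∈ S) (hz : z ∈ S) :
    T.tri x y z ∈ S :=
  S.sub_mem (S.sub_mem (h _ (S.add_mem hx hz) _ hy) (h _ hx _ hy)) (h _ hz _ hy)

/-- The quadratic operator of a subsystem. -/
def restrictP (T : JordanTripleSystem k J) (S : Submodule k J) (h : T.IsSubsystem S) :
    QuadraticMap k S (Module.End k S) where
  toFun x := (T.P x).restrict (fun y hy => h x x.2 y hy)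
  toFun_smul a x := by
    ext y; simp [QuadraticMap.map_smul]
  exists_companion' := by
    refine ⟨LinearMap.mk₂ k
      (fun x z => (QuadraticMap.polar T.P (x : J) (z : J)).restrict
        (fun y hy => h.tri_mem x.2 hy z.2)) ?_ ?_ ?_ ?_, ?_⟩
    · intro x x' z; ext y; exact T.tri_add_left (x : J) x' y z
    · intro a x z; ext y; exact T.tri_smul_left a (x : J) y z
    · intro x z z'; ext y; exact T.tri_add_right (x : J) y z z'
    · intro a x z; ext y; exact T.tri_smul_right a (x : J) y z
    · intro x z; ext y
      simp [QuadraticMap.polar]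

lemma coe_restrictP (T : JordanTripleSystem k J) (S : Submodule k J) (h : T.IsSubsystem S)
    (x y : S) : ((T.restrictP S h x y : S) : J) = T.P x y := rfl

lemma coe_tripleOf_restrictP (T : JordanTripleSystem k J) (S : Submodule k J)
    (h : T.IsSubsystem S) (x y z : S) :
    ((tripleOf (T.restrictP S h) x y z : S) : J) = tripleOf T.P (x : J) y z := rfl

/-- A subsystem, as a Jordan triple system in its own right. -/
def restrict (T : JordanTripleSystem k J) (S : Submodule k J) (h : T.IsSubsystem S) :
    JordanTripleSystem k S where
  P := T.restrictP S h
  jp1 x y z := Subtype.ext (T.jp1 x y z)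
  jp1_lin x w y z := Subtype.ext (T.jp1_lin x w y z)
  jp2 x y z := Subtype.ext (T.jp2 x y z)
  jp3 x y z := Subtype.ext (T.jp3 x y z)
  jp3_lin31 x w y z := Subtype.ext (T.jp3_lin31 x w y z)
  jp3_lin22 x w y z := Subtype.ext (T.jp3_lin22 x w y z)

/-- `J = ⨁ J^i` is a grading of the Jordan triple system by the abelian group `Λ`. -/
structure IsGrading {Λ : Type*} [AddCommGroup Λ] (T : JordanTripleSystem k J)
    (G : Λ → Submodule k J) : Prop where
  directSum : IsDirectSumOf G
  P_mem : ∀ i j : Λ, ∀ x ∈ G i, ∀ y ∈ G j, T.P x y ∈ G (i + i + j)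
  tri_mem : ∀ i j l : Λ, ∀ x ∈ G i, ∀ y ∈ G j, ∀ z ∈ G l, T.tri x y z ∈ G (i + j + l)

/-- A submodule `S` is graded if `S = ⨁ (S ∩ J^i)`. -/
def IsGradedSubmodule {Λ : Type*} (G : Λ → Submodule k J) (S : Submodule k J) : Prop :=
  S = ⨆ i, S ⊓ G i

/-- The family `S ∩ J^i`, as a family of submodules of `S`. -/
def inducedGrading {Λ : Type*} (G : Λ → Submodule k J) (S : Submodule k J) :
    Λ → Submodule k S :=
  fun i => (G i).comap S.subtype

/-- A linear bijection that is a homomorphism of Jordan triple systems, homogeneous of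
degree `0`. (Compatibility with `P` gives compatibility with the triple product.) -/
structure IsGradedIso {Λ J' : Type*} [AddCommGroup J'] [Module k J']
    (T : JordanTripleSystem k J) (G : Λ → Submodule k J)
    (T' : JordanTripleSystem k J') (G' : Λ → Submodule k J') (φ : J ≃ₗ[k] J') : Prop where
  map_P : ∀ x y : J, φ (T.P x y) = T'.P (φ x) (φ y)
  map_mem : ∀ i : Λ, ∀ x ∈ G i, φ x ∈ G' i

/-! ### Peirce spaces and triangles -/

/-- `P(e)e = e`. -/
def IsTripotent (T : JordanTripleSystem k J) (e : J) : Prop := T.P e e = e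

/-- The operator `z ↦ {x y z}`. -/
def D (T : JordanTripleSystem k J) (x y : J) : Module.End k J where
  toFun z := T.tri x y z
  map_add' := T.tri_add_right x y
  map_smul' a := T.tri_smul_right a x y

/-- Peirce `2`-space of a tripotent: the image of `P(e)`. -/
def peirce₂ (T : JordanTripleSystem k J) (e : J) : Submodule k J := LinearMap.range (T.P e)

/-- Peirce `1`-space of a tripotent: the `x` with `{e e x} = x`. -/
def peirce₁ (T : JordanTripleSystem k J) (e : J) : Submodule k J :=
  LinearMap.ker (T.D e e - 1)

/-- Peirce `0`-space of a tripotent: the `x` with `{e e x} = 0` and `P(e)x = 0`. -/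
def peirce₀ (T : JordanTripleSystem k J) (e : J) : Submodule k J :=
  LinearMap.ker (T.D e e) ⊓ LinearMap.ker (T.P e)

lemma mem_peirce₁ (T : JordanTripleSystem k J) (e x : J) :
    x ∈ T.peirce₁ e ↔ T.tri e e x = x := by
  simp [peirce₁, D, sub_eq_zero]

lemma mem_peirce₀ (T : JordanTripleSystem k J) (e x : J) :
    x ∈ T.peirce₀ e ↔ T.tri e e x = 0 ∧ T.P e x = 0 := by
  simp [peirce₀, D]

/-- A triangle `(u; e₁, e₂)` in a Jordan triple system. -/
structure Triangle (T : JordanTripleSystem k J) where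
  u : J
  e₁ : J
  e₂ : J
  u_ne_zero : u ≠ 0
  e₁_ne_zero : e₁ ≠ 0
  e₂_ne_zero : e₂ ≠ 0
  u_tripotent : T.IsTripotent u
  e₁_tripotent : T.IsTripotent e₁
  e₂_tripotent : T.IsTripotent e₂
  e₁_mem_zero : e₁ ∈ T.peirce₀ e₂
  e₂_mem_zero : e₂ ∈ T.peirce₀ e₁
  e₁_mem_two : e₁ ∈ T.peirce₂ u
  e₂_mem_two : e₂ ∈ T.peirce₂ u
  u_mem_one₁ : u ∈ T.peirce₁ e₁
  u_mem_one₂ : u ∈ T.peirce₁ e₂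
  P_u_e₁ : T.P u e₁ = e₂
  P_u_e₂ : T.P u e₂ = e₁
  tri_e₁_u_e₂ : T.tri e₁ u e₂ = u

/-! Peirce rules needed for the definitions below. -/

section peirce

variable (T : JordanTripleSystem k J)

lemma P_sq_of_tripotent {e : J} (he : T.IsTripotent e) (x : J) :
    T.P e (T.P e (T.P e x)) = T.P e x := by
  have := T.jp3 e e x
  rw [he] at this
  exact this.symm

lemma tri_eee {e : J} (he : T.IsTripotent e) : T.tri e e e = e + e := by
  rw [tri_self, he]

lemma P_peirce₁ {e m : J} (he : T.IsTripotent e) (hm : m ∈ T.peirce₁ e) : T.P e m = 0 := by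
  rw [mem_peirce₁] at hm
  have h := T.jp3_lin31 e m e e
  change T.tri _ _ (T.tri _ _ _) = T.tri _ _ _ + T.P _ (T.P _ (T.tri _ _ _)) at h
  simp only [show T.P e e = e from he, hm] at h
  have h0 : T.P e (T.P e m) = 0 := by simpa using h
  rw [← T.P_sq_of_tripotent he m, h0, map_zero]

lemma tri_peirce₂ {e x : J} (he : T.IsTripotent e) (hx : x ∈ T.peirce₂ e) :
    T.tri e e x = x + x := by
  obtain ⟨y, rfl⟩ := hx
  have h1 := T.jp1 e e y
  change T.tri _ _ _ = T.P _ (T.tri _ _ _) at h1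
  have h5 := T.jp7 e y e e
  rw [show T.P e e = e from he] at h5
  rw [tri_self, tri_self, T.tri_comm y e e, ← h1, T.tri_comm (T.P e y) e e] at h5
  have : T.tri e e (T.P e y) = T.P e y + T.P e y := by
    have := congrArg (fun t => t - T.tri e e (T.P e y)) h5
    simpa using this.symm
  exact this

lemma D_orth {e f : J} (he : T.IsTripotent e) (hf : f ∈ T.peirce₀ e) (z : J) :
    T.tri e f z = 0 := by
  rw [mem_peirce₀] at hf
  have h := T.jp7 e e f z
  rw [show T.P e e = e from he, hf.1, hf.2, tri_zero_left, tri_zero_mid, add_zero] at h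
  exact h

/-- If `e ⟂ f` are orthogonal tripotents, then `{f, J₂(e), J} = 0`. -/
lemma tri_orth_mid {e f x : J} (hf' : T.IsTripotent f)
    (hf : f ∈ T.peirce₀ e) (he' : e ∈ T.peirce₀ f) (hx : x ∈ T.peirce₂ e) (z : J) :
    T.tri f x z = 0 := by
  obtain ⟨w, rfl⟩ := hx
  have h := T.jp8 f w e z
  rw [T.D_orth hf' he', tri_zero_left, ((T.mem_peirce₀ e f).1 hf).2, tri_zero_mid,
    add_zero] at h
  exact h.symm

/-- If `e ⟂ f` are orthogonal tripotents, then `{J₂(e), f, J} = 0`. -/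
lemma tri_orth_left {e f x : J} (hf' : T.IsTripotent f)
    (hf : f ∈ T.peirce₀ e) (he' : e ∈ T.peirce₀ f) (hx : x ∈ T.peirce₂ e) (z : J) :
    T.tri x f z = 0 := by
  obtain ⟨y, rfl⟩ := hx
  have h := T.jp7 e y f z
  rw [((T.mem_peirce₀ e f).1 hf).2, tri_zero_left, add_zero, T.tri_comm y e f,
    T.D_orth hf' he', tri_zero_mid] at h
  exact h

lemma P_orth {e f x : J} (he : T.IsTripotent e) (hf' : T.IsTripotent f)
    (hf : f ∈ T.peirce₀ e) (he' : e ∈ T.peirce₀ f) (hx : x ∈ T.peirce₂ e) :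
    T.P f x = 0 := by
  have hx0 := hx
  obtain ⟨w, rfl⟩ := hx
  have h := T.jp3_lin22 e f e (T.P e w)
  change T.P (T.tri _ _ _) _ + T.tri _ _ _ = T.P _ _ + T.P _ _ + T.tri _ (T.P _ (T.tri _ _ _)) _
    at h
  have hfe := (T.mem_peirce₀ e f).1 hf
  have hef := (T.mem_peirce₀ f e).1 he'
  have h0 := T.jp3 e f w
  rw [hfe.2] at h0
  have h1 : T.P e (T.P f (T.P e w)) = 0 := by rw [← h0]; simp
  have h2 : T.tri e (T.P e w) f = 0 := by
    rw [T.tri_comm, T.tri_orth_mid hf' hf he' hx0]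
  rw [hfe.1, hef.2, h1, h2, P_sq_of_tripotent T he] at h
  simpa [tri_zero_mid, tri_zero_right] using h.symm

end peirce

namespace Triangle

variable {T : JordanTripleSystem k J} (Δ : T.Triangle)

/-- The Peirce space `J₁ = J₂(e₁)`. -/
def J₁ : Submodule k J := T.peirce₂ Δ.e₁

/-- The Peirce space `J₂ = J₂(e₂)`. -/
def J₂ : Submodule k J := T.peirce₂ Δ.e₂

/-- The off-diagonal Peirce space `M = J₁(e₁) ∩ J₁(e₂)`. -/
def M : Submodule k J := T.peirce₁ Δ.e₁ ⊓ T.peirce₁ Δ.e₂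

/-- `J` is triangulated by the triangle: `J = J₁ ⊕ M ⊕ J₂`. -/
def IsTriangulating : Prop := IsDirectSumOf ![Δ.J₁, Δ.M, Δ.J₂]

/-- `J` is graded-triangulated by the triangle: `J` is graded, triangulated by `(u; e₁, e₂)`, and
`u, e₁, e₂` lie in degree `0`. -/
structure IsGradedTriangulating {Λ : Type*} [AddCommGroup Λ] (G : Λ → Submodule k J) : Prop where
  isGrading : T.IsGrading G
  isTriangulating : Δ.IsTriangulating
  u_mem : Δ.u ∈ G 0
  e₁_mem : Δ.e₁ ∈ G 0
  e₂_mem : Δ.e₂ ∈ G 0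

/-- The triangulation is faithful: `x₁ ∈ J₁` and `x₁ · u = {x₁ e₁ u} = 0` imply `x₁ = 0`. -/
def IsFaithful : Prop := ∀ x ∈ Δ.J₁, T.tri x Δ.e₁ Δ.u = 0 → x = 0

lemma u_mem_M : Δ.u ∈ Δ.M := ⟨Δ.u_mem_one₁, Δ.u_mem_one₂⟩

/-- `u` as an element of `M`. -/
def uM : Δ.M := ⟨Δ.u, Δ.u_mem_M⟩

/-- The tripotent `e = e₁ + e₂`. -/
def e : J := Δ.e₁ + Δ.e₂

lemma tri_mem_M {x m : J} (hx : x ∈ Δ.J₁) (hm : m ∈ Δ.M) : T.tri x Δ.e₁ m ∈ Δ.M := by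
  obtain ⟨hm1, hm2⟩ := hm
  rw [SetLike.mem_coe, mem_peirce₁] at hm1 hm2
  refine ⟨?_, ?_⟩
  · rw [SetLike.mem_coe, mem_peirce₁]
    have h := T.tri_tri Δ.e₁ Δ.e₁ x Δ.e₁ m
    rw [T.tri_peirce₂ Δ.e₁_tripotent hx, T.tri_eee Δ.e₁_tripotent, hm1, tri_add_left,
      tri_add_mid, add_right_comm] at h
    have h' := congrArg (fun t => t - T.tri x Δ.e₁ m - T.tri x Δ.e₁ m) h
    simp only [add_sub_cancel_right] at h'
    have e1 : ∀ a b : J, a + (b + b) - b - b = a := fun a b => by abel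
    have e2 : ∀ b : J, b + b + b - b - b = b := fun b => by abel
    simpa [e1, e2] using h'
  · rw [SetLike.mem_coe, mem_peirce₁]
    have h := T.tri_tri Δ.e₂ Δ.e₂ x Δ.e₁ m
    have h2 : T.tri Δ.e₂ Δ.e₂ x = 0 := by
      rw [T.tri_comm]
      exact T.tri_orth_left Δ.e₂_tripotent Δ.e₂_mem_zero Δ.e₁_mem_zero hx _
    rw [h2, ((T.mem_peirce₀ _ _).1 Δ.e₁_mem_zero).1, hm2, tri_zero_left, tri_zero_mid] at h
    simpa using h

lemma P_e_mem_M {m : J} (hm : m ∈ Δ.M) : T.P Δ.e m ∈ Δ.M := by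
  obtain ⟨hm1, hm2⟩ := hm
  have hP : T.P Δ.e m = T.tri Δ.e₁ m Δ.e₂ := by
    rw [e, P_add, T.P_peirce₁ Δ.e₁_tripotent hm1, T.P_peirce₁ Δ.e₂_tripotent hm2]
    simp
  rw [hP]
  rw [SetLike.mem_coe, mem_peirce₁] at hm1 hm2
  refine ⟨?_, ?_⟩
  · rw [SetLike.mem_coe, mem_peirce₁]
    have h := T.tri_tri Δ.e₁ Δ.e₁ Δ.e₁ m Δ.e₂
    rw [T.tri_eee Δ.e₁_tripotent, hm1, ((T.mem_peirce₀ _ _).1 Δ.e₂_mem_zero).1, tri_add_left,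
      tri_zero_right, add_zero] at h
    exact add_right_cancel h
  · rw [SetLike.mem_coe, mem_peirce₁]
    have h := T.tri_tri Δ.e₂ Δ.e₂ Δ.e₁ m Δ.e₂
    rw [T.tri_eee Δ.e₂_tripotent, hm2, ((T.mem_peirce₀ _ _).1 Δ.e₁_mem_zero).1, tri_add_right,
      tri_zero_left, zero_add] at h
    exact add_right_cancel h

lemma star_mem_J₁ {x : J} (hx : x ∈ Δ.J₂) : T.P Δ.e (T.P Δ.u x) ∈ Δ.J₁ := by
  obtain ⟨y, rfl⟩ := hx
  have h1 : ∀ z, T.P Δ.e₁ z = T.P Δ.u (T.P Δ.e₂ (T.P Δ.u z)) := fun z => by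
    rw [← T.jp3, Δ.P_u_e₂]
  have h2 : ∀ z, T.P Δ.e₂ z = T.P Δ.u (T.P Δ.e₁ (T.P Δ.u z)) := fun z => by
    rw [← T.jp3, Δ.P_u_e₁]
  have h3 : T.P Δ.u (T.P Δ.e₂ y) = T.P Δ.e₁ (T.P Δ.u y) := by
    have h4 : T.P Δ.u (T.P Δ.u (T.P Δ.e₁ (T.P Δ.u y))) = T.P Δ.e₁ (T.P Δ.u y) := by
      rw [h1 (T.P Δ.u y), T.P_sq_of_tripotent Δ.u_tripotent]
    rw [h2 y, h4]
  rw [h3]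
  have hmem : T.P Δ.e₁ (T.P Δ.u y) ∈ T.peirce₂ Δ.e₁ := ⟨_, rfl⟩
  rw [e, P_add, T.P_orth Δ.e₁_tripotent Δ.e₂_tripotent Δ.e₂_mem_zero Δ.e₁_mem_zero hmem,
    T.tri_comm, T.tri_orth_mid Δ.e₂_tripotent Δ.e₂_mem_zero Δ.e₁_mem_zero hmem, add_zero, add_zero]
  exact ⟨_, rfl⟩

/-- The element `x₂* = P(e)P(u)x₂ ∈ J₁`, for `x₂ ∈ J₂`. -/
def star (x : Δ.J₂) : Δ.J₁ := ⟨T.P Δ.e (T.P Δ.u x), Δ.star_mem_J₁ x.2⟩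

/-- The map `m ↦ P(e)m` on `M`. -/
def barM : Module.End k Δ.M := (T.P Δ.e).restrict (fun _ hm => Δ.P_e_mem_M hm)

/-- The map `L : J₁ → End_k(M)`, `L(x₁)m = {x₁ e₁ m}`. -/
def L : Δ.J₁ →ₗ[k] Module.End k Δ.M where
  toFun x := (T.D x Δ.e₁).restrict (fun _ hm => Δ.tri_mem_M x.2 hm)
  map_add' x y := by
    ext m; exact T.tri_add_left x y Δ.e₁ m
  map_smul' a x := by
    ext m; exact T.tri_smul_left a x Δ.e₁ m

/-- `C`, the subalgebra of `End_k(M)` generated by `L(J₁)`. -/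
def C : Subalgebra k (Module.End k Δ.M) := Algebra.adjoin k (Set.range Δ.L)

/-- `L`, as a map `J₁ → C`. -/
def LC : Δ.J₁ →ₗ[k] Δ.C :=
  LinearMap.codRestrict (Subalgebra.toSubmodule Δ.C) Δ.L
    (fun x => Algebra.subset_adjoin ⟨x, rfl⟩)

/-- `π` is the reversal involution of `C`:
`(L(x₁) ⋯ L(xₙ))^π = L(xₙ) ⋯ L(x₁)`. As the products `L(x₁) ⋯ L(xₙ)` span `C`, this determines
the linear map `π`. -/
def IsReversal (π : Δ.C →ₗ[k] Δ.C) : Prop :=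
  ∀ l : List Δ.J₁, π (l.map Δ.LC).prod = (l.map Δ.LC).reverse.prod

/-- The homogeneous part `C^i = C ∩ End_k^i(M)`, where `End_k^i(M)` consists of the `f` with
`f(M^j) ⊆ M^{j+i}` for all `j`. -/
def gradedC {Λ : Type*} [AddCommGroup Λ] (G : Λ → Submodule k J) (i : Λ) : Submodule k Δ.C where
  carrier := {c | ∀ (j : Λ) (m : Δ.M), (m : J) ∈ G j → ((c : Module.End k Δ.M) m : J) ∈ G (j + i)}
  add_mem' {a b} ha hb j m hm := by
    simpa using (G (j + i)).add_mem (ha j m hm) (hb j m hm)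
  zero_mem' j m _ := by simp
  smul_mem' a c hc j m hm := by
    simpa using (G (j + i)).smul_mem a (hc j m hm)

/-- The submodule `Cu = {cu : c ∈ C}` of `M`. -/
def Cu : Submodule k Δ.M :=
  (Subalgebra.toSubmodule Δ.C).map (LinearMap.applyₗ Δ.uM)

lemma apply_mem_Cu (c : Δ.C) {m : Δ.M} (hm : m ∈ Δ.Cu) : (c : Module.End k Δ.M) m ∈ Δ.Cu := by
  obtain ⟨d, hd, rfl⟩ := hm
  exact ⟨c * d, Δ.C.mul_mem c.2 hd, rfl⟩

/-- Restriction of the elements of `C` to `Cu`. -/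
def resCu : Δ.C →ₐ[k] Module.End k Δ.Cu where
  toFun c := (c : Module.End k Δ.M).restrict (fun _ hm => Δ.apply_mem_Cu c hm)
  map_one' := by ext; rfl
  map_mul' _ _ := by ext; rfl
  map_zero' := by ext; rfl
  map_add' _ _ := by ext; rfl
  commutes' _ := by ext; rfl

/-- The algebra `A = C|_{Cu}`. -/
def A : Subalgebra k (Module.End k Δ.Cu) := Δ.resCu.range

instance : Ring Δ.A := Subalgebra.toRing (R := k) (A := Module.End k Δ.Cu) Δ.A

/-- The restriction map `C → A = C|_{Cu}`. -/
def toA : Δ.C →ₐ[k] Δ.A := Δ.resCu.rangeRestrict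

/-- The submodule `A₀ = C₀|_{Cu}` with `C₀ = L(J₁)`. -/
def A₀ : Submodule k Δ.A := LinearMap.range (Δ.toA.toLinearMap ∘ₗ Δ.LC)

/-- The homogeneous part `A^i = C^i|_{Cu}`. -/
def gradedA {Λ : Type*} [AddCommGroup Λ] (G : Λ → Submodule k J) (i : Λ) : Submodule k Δ.A :=
  (Δ.gradedC G i).map Δ.toA.toLinearMap

/-- `J_h = J₁ ⊕ Cu ⊕ J₂`. -/
def Jh : Submodule k J := Δ.J₁ ⊔ Δ.Cu.map Δ.M.subtype ⊔ Δ.J₂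

lemma mem_Jh (x₁ : Δ.J₁) (c : Δ.C) (x₂ : Δ.J₂) :
    (x₁ : J) + ((c : Module.End k Δ.M) Δ.uM : J) + (x₂ : J) ∈ Δ.Jh :=
  Submodule.add_mem_sup
    (Submodule.add_mem_sup x₁.2 ⟨(c : Module.End k Δ.M) Δ.uM, ⟨c, c.2, rfl⟩, rfl⟩) x₂.2

/-- The element `x₁ ⊕ cu ⊕ x₂` of `J_h`. -/
def mkJh (x₁ : Δ.J₁) (c : Δ.C) (x₂ : Δ.J₂) : Δ.Jh :=
  ⟨(x₁ : J) + ((c : Module.End k Δ.M) Δ.uM : J) + (x₂ : J), Δ.mem_Jh x₁ c x₂⟩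

end Triangle

/-! ### Hermitian matrix systems -/

/-- The quadratic map `P(x)y = x (b y) x` on an associative algebra with endomorphism `b`. -/
def assocP {B : Type*} [Ring B] [Algebra k B] (b : B →ₐ[k] B) :
    QuadraticMap k B (Module.End k B) where
  toFun x := LinearMap.mulLeftRight k (x, x) ∘ₗ b.toLinearMap
  toFun_smul a x := by
    ext y; simp [mul_smul]
  exists_companion' := by
    refine ⟨LinearMap.mk₂ k (fun x z => LinearMap.mulLeftRight k (x, z) ∘ₗ b.toLinearMap
      + LinearMap.mulLeftRight k (z, x) ∘ₗ b.toLinearMap) ?_ ?_ ?_ ?_, ?_⟩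
    · intro x x' z; ext y; simp [add_mul, mul_add]; abel
    · intro a x z; ext y; simp
    · intro x z z'; ext y; simp [add_mul, mul_add]; abel
    · intro a x z; ext y; simp
    · intro x z; ext y; simp [add_mul, mul_add]; abel

lemma assocP_apply {B : Type*} [Ring B] [Algebra k B] (b : B →ₐ[k] B) (x y : B) :
    assocP b x y = x * b y * x := rfl

lemma tripleOf_assocP {B : Type*} [Ring B] [Algebra k B] (b : B →ₐ[k] B) (x y z : B) :
    tripleOf (assocP b) x y z = x * b y * z + z * b y * x := by
  simp only [tripleOf, QuadraticMap.polar, LinearMap.sub_apply, assocP_apply]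
  noncomm_ring

/-- An associative algebra `B` with an automorphism `b` of period `2` is a Jordan triple system
with `P(x)y = x (b y) x`. -/
def assocSystem {B : Type*} [Ring B] [Algebra k B] (b : B →ₐ[k] B) (hb : ∀ x, b (b x) = x) :
    JordanTripleSystem k B where
  P := assocP b
  jp1 x y z := by
    simp only [tripleOf_assocP, assocP_apply, map_mul, map_add, hb]; noncomm_ring
  jp1_lin x w y z := by
    simp only [tripleOf_assocP, assocP_apply, map_mul, map_add, hb]; noncomm_ring
  jp2 x y z := by
    simp only [tripleOf_assocP, assocP_apply, map_mul, hb]; noncomm_ring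
  jp3 x y z := by
    simp only [assocP_apply, map_mul, hb]; noncomm_ring
  jp3_lin31 x w y z := by
    simp only [tripleOf_assocP, assocP_apply, map_mul, map_add, hb]; noncomm_ring
  jp3_lin22 x w y z := by
    simp only [tripleOf_assocP, assocP_apply, map_mul, map_add, hb]; noncomm_ring

end JordanTripleSystem

/-- An associative coordinate system `(A, A₀, π, ¯)`: a unital associative `k`-algebra `A` with an
involution `π`, an automorphism `¯` of period `2` commuting with `π`, and a `¯`-stable `π`-ample
subspace `A₀`. -/
structure CoordinateSystem (k A : Type*) [CommRing k] [Ring A] [Algebra k A] where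
  π : A →ₗ[k] A
  π_mul : ∀ a b, π (a * b) = π b * π a
  π_π : ∀ a, π (π a) = a
  bar : A →ₐ[k] A
  bar_bar : ∀ a, bar (bar a) = a
  bar_π : ∀ a, bar (π a) = π (bar a)
  A₀ : Submodule k A
  bar_mem : ∀ a ∈ A₀, bar a ∈ A₀
  π_eq : ∀ a ∈ A₀, π a = a
  one_mem : 1 ∈ A₀
  ample : ∀ a, ∀ b ∈ A₀, a * b * π a ∈ A₀

namespace CoordinateSystem

variable {k A : Type*} [CommRing k] [Ring A] [Algebra k A]

/-- The coordinate system is graded by the family `𝒜`: `A = ⨁ A^i` is a graded algebra, `π` and `¯`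
are homogeneous of degree `0`, and `A₀` is a graded submodule. -/
structure IsGraded {Λ : Type*} [AddCommGroup Λ] (X : CoordinateSystem k A)
    (𝒜 : Λ → Submodule k A) : Prop where
  directSum : IsDirectSumOf 𝒜
  gradedMonoid : SetLike.GradedMonoid 𝒜
  π_mem : ∀ i, ∀ a ∈ 𝒜 i, X.π a ∈ 𝒜 i
  bar_mem : ∀ i, ∀ a ∈ 𝒜 i, X.bar a ∈ 𝒜 i
  A₀_graded : X.A₀ = ⨆ i, X.A₀ ⊓ 𝒜 i

/-- The coordinate system is diagonal if `A₀` generates the algebra `A`. -/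
def IsDiagonal (X : CoordinateSystem k A) : Prop :=
  Algebra.adjoin k (X.A₀ : Set A) = ⊤

/-- All `2 × 2` matrices over `A`, with `P(X)Y = X Ȳ X`, the automorphism `¯` being applied to the
entries. -/
def matrixSystem (X : CoordinateSystem k A) :
    JordanTripleSystem k (Matrix (Fin 2) (Fin 2) A) :=
  JordanTripleSystem.assocSystem X.bar.mapMatrix (fun Y => by ext i j; simp [X.bar_bar])

lemma matrixSystem_P (X : CoordinateSystem k A) (Y Z : Matrix (Fin 2) (Fin 2) A) :
    X.matrixSystem.P Y Z = Y * Z.map X.bar * Y := rfl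

/-- The module `H₂(A, A₀, π, ¯)` of hermitian `2 × 2` matrices (`X = X^{πt}`) over `A` with
diagonal entries in `A₀`. -/
def H₂ (X : CoordinateSystem k A) : Submodule k (Matrix (Fin 2) (Fin 2) A) where
  carrier := {Y | (∀ i j, Y i j = X.π (Y j i)) ∧ ∀ i, Y i i ∈ X.A₀}
  add_mem' {Y Z} hY hZ := by
    refine ⟨fun i j => ?_, fun i => X.A₀.add_mem (hY.2 i) (hZ.2 i)⟩
    rw [Matrix.add_apply, Matrix.add_apply, map_add, ← hY.1, ← hZ.1]
  zero_mem' := by simp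
  smul_mem' a Y hY := by
    refine ⟨fun i j => ?_, fun i => X.A₀.smul_mem a (hY.2 i)⟩
    rw [Matrix.smul_apply, Matrix.smul_apply, map_smul, ← hY.1]

lemma mem_H₂ (X : CoordinateSystem k A) (Y : Matrix (Fin 2) (Fin 2) A) :
    Y ∈ X.H₂ ↔ (∀ i j, Y i j = X.π (Y j i)) ∧ ∀ i, Y i i ∈ X.A₀ := Iff.rfl

lemma ample_lin (X : CoordinateSystem k A) (c : A) {b : A} (hb : b ∈ X.A₀) :
    b * X.π c + c * b ∈ X.A₀ := by
  have hπ1 : X.π 1 = 1 := X.π_eq 1 X.one_mem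
  have h := X.A₀.sub_mem (X.A₀.sub_mem (X.ample (1 + c) b hb) hb) (X.ample c b hb)
  rw [map_add, hπ1] at h
  convert h using 1
  noncomm_ring

lemma isSubsystem_H₂ (X : CoordinateSystem k A) : X.matrixSystem.IsSubsystem X.H₂ := by
  intro Y hY Z hZ
  rw [matrixSystem_P]
  have hb : ∀ i j, X.π (X.bar (Z i j)) = X.bar (Z j i) := fun i j => by
    rw [← X.bar_π, ← hZ.1]
  refine ⟨fun i j => ?_, fun i => ?_⟩
  · simp only [Matrix.mul_apply, Matrix.map_apply, Fin.sum_univ_two, map_add, X.π_mul, hb, ← hY.1]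
    noncomm_ring
  · have h1 : ∀ i j, Y i j * X.bar (Z j j) * Y j i ∈ X.A₀ := fun i j => by
      rw [hY.1 j i]
      exact X.ample _ _ (X.bar_mem _ (hZ.2 j))
    have h2 : ∀ i j, Y i i * X.bar (Z i j) * Y j i + Y i j * X.bar (Z j i) * Y i i ∈ X.A₀ :=
      fun i j => by
        have := X.ample_lin (Y i j * X.bar (Z j i)) (hY.2 i)
        rwa [X.π_mul, hb, ← hY.1 j i, ← mul_assoc] at this
    fin_cases i
    · have := X.A₀.add_mem (X.A₀.add_mem (h1 0 0) (h1 0 1)) (h2 0 1)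
      convert this using 1
      simp [Matrix.mul_apply]; noncomm_ring
    · have := X.A₀.add_mem (X.A₀.add_mem (h1 1 1) (h1 1 0)) (h2 1 0)
      convert this using 1
      simp [Matrix.mul_apply]; noncomm_ring

/-- The hermitian matrix system `H₂(A, A₀, π, ¯)`, a Jordan triple system. -/
def hermitianSystem (X : CoordinateSystem k A) : JordanTripleSystem k X.H₂ :=
  X.matrixSystem.restrict X.H₂ X.isSubsystem_H₂

/-- The grading of the hermitian matrix system: `H^i` consists of the matrices in `H` with all
entries in `A^i`, i.e. it is spanned by the `a₀[11]`, `a₀[22]`, `a[12]` with `a₀ ∈ A₀^i`,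
`a ∈ A^i`. -/
def gradedH₂ {Λ : Type*} (X : CoordinateSystem k A) (𝒜 : Λ → Submodule k A) (i : Λ) :
    Submodule k X.H₂ where
  carrier := {Y | ∀ r s, (Y : Matrix (Fin 2) (Fin 2) A) r s ∈ 𝒜 i}
  add_mem' hY hZ r s := (𝒜 i).add_mem (hY r s) (hZ r s)
  zero_mem' _ _ := (𝒜 i).zero_mem
  smul_mem' a _ hY r s := (𝒜 i).smul_mem a (hY r s)

end CoordinateSystem

/-!
# Coordinatization of faithfully triangulated Jordan triple systems

Let `τ = P(e)P(u)`. As `P(e)` and `P(u)` are commuting involutive automorphisms of `J` (`P_e_P_e`,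
`P_u_P_u`, `P_e_P_u`), so is `τ`; it fixes `u` and exchanges `e₁` and `e₂`. Conjugation by `τ`
turns the action `L` of `J₁` on `M` into the action `m ↦ {x₂ e₂ m}` of `J₂`. By orthogonality of
`J₁` and `J₂` the two actions commute, so `C` commutes with `τCτ` (`conj_comm`), and since
`τL(x)u = L(x)u`, the reversal `c^π` of a product `c = L(x₁) ⋯ L(xₙ)` satisfies `c^π u = τ(cu)`.

The reversal is well defined because of the trace `t(m) = {m e₂ u}`, a linear map `M → J₁` with
`L(t(cu)) = c + c^π` for every such product `c` (`L_trace_word`, by induction on the length).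
Hence `c ↦ L(t(cu)) - c` is a linear map on `C` that reverses products. The formula involves `c`
only through `cu` and `c` itself, so it also makes sense on `A = C|_{Cu}`. Moreover `Cu = (τCτ)u`,
and an element of `C` commutes with `τCτ`, so `c|_{Cu}` is determined by `cu` (`toA_eq_of_uM`):
evaluation at `u` identifies `A` with `Cu`, and gradings of `A` can be compared with that of `J`
along this injective map.

The products of `J_h` are then computed in `C`, where `c̄ = P(e)cP(e)`: the linearized trace
identity `L({cu, e₂, du}) = cd^π + dc^π` (`LC_form`), the formula `L(P(cu)y) = c L(P(e)y*) c^π`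
for `y ∈ J₂` (`LC_PM`), which also shows that `A₀` is ample, and `P(cu)du = (c d̄^π c)u`
(`P_C_C`). Assembled in `P_mkJh`, they say that `J_h` is closed under the product and that, in
terms of the matrices attached to its elements, the product is `X Ȳ X` (`toMatrix_P`).
Faithfulness enters only in the injectivity of `x₁ ↦ L(x₁)|_{Cu}` (`toA_LC_injective`), hence of
the coordinatization map.
-/

namespace JordanTripleSystem

variable {k J : Type*} [CommRing k] [AddCommGroup J] [Module k J]

/-! ### Identities of Jordan triple systems -/

section identities

variable (T : JordanTripleSystem k J)

/-- The full linearization of `{P(x)y, y, z} = {x, P(y)x, z}`. -/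
lemma tri_tri_mid (x y w v z : J) :
    T.tri x (T.tri y w v) z + T.tri w (T.tri y x v) z =
      T.tri (T.tri x y w) v z + T.tri (T.tri x v w) y z := by
  have h := T.jp7 (x + w) y v z
  have h1 := T.jp7 x y v z
  have h2 := T.jp7 w y v z
  simp only [P_add, tri_add_left, tri_add_mid] at h
  have e : ∀ a b c d a' b' c' d' p q : J, a' + d' = p → b' + c' = q →
      a + (a' + b') + (c' + d') = b → a + p + q = b := by
    rintro a b c d a' b' c' d' p q rfl rfl rfl; abel
  rw [← sub_eq_zero] at h h1 h2 ⊢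
  have : ∀ a b c : J, a = 0 → b = 0 → c = 0 → b + c - a = 0 := by
    rintro a b c rfl rfl rfl; simp
  rw [← this _ _ _ h h1 h2]
  abel

/-- If `P(v)² = 1`, then `P(v)` is an automorphism. -/
lemma P_P_of_involutive {v : J} (hv : ∀ x, T.P v (T.P v x) = x) (x y : J) :
    T.P v (T.P x y) = T.P (T.P v x) (T.P v y) := by
  have := T.jp3 v x (T.P v y)
  rw [hv] at this
  exact this.symm

lemma tri_of_involutive {v : J} (hv : ∀ x, T.P v (T.P v x) = x) (x y z : J) :
    T.P v (T.tri x y z) = T.tri (T.P v x) (T.P v y) (T.P v z) := by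
  simp only [tri_def, map_sub, P_P_of_involutive T hv, map_add]

end identities

namespace Triangle

variable {T : JordanTripleSystem k J} (Δ : T.Triangle)

/-! ### Triangles -/

/-- The triangle `(u; e₂, e₁)`, through which statements on `J₁` carry over to `J₂`. -/
def swap : T.Triangle where
  u := Δ.u
  e₁ := Δ.e₂
  e₂ := Δ.e₁
  u_ne_zero := Δ.u_ne_zero
  e₁_ne_zero := Δ.e₂_ne_zero
  e₂_ne_zero := Δ.e₁_ne_zero
  u_tripotent := Δ.u_tripotent
  e₁_tripotent := Δ.e₂_tripotent
  e₂_tripotent := Δ.e₁_tripotent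
  e₁_mem_zero := Δ.e₂_mem_zero
  e₂_mem_zero := Δ.e₁_mem_zero
  e₁_mem_two := Δ.e₂_mem_two
  e₂_mem_two := Δ.e₁_mem_two
  u_mem_one₁ := Δ.u_mem_one₂
  u_mem_one₂ := Δ.u_mem_one₁
  P_u_e₁ := Δ.P_u_e₂
  P_u_e₂ := Δ.P_u_e₁
  tri_e₁_u_e₂ := by rw [T.tri_comm]; exact Δ.tri_e₁_u_e₂

lemma swap_e : Δ.swap.e = Δ.e := add_comm _ _

lemma mem_swap_M {m : J} (hm : m ∈ Δ.M) : m ∈ Δ.swap.M := ⟨hm.2, hm.1⟩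

lemma e₁_mem_J₁ : Δ.e₁ ∈ Δ.J₁ := ⟨Δ.e₁, Δ.e₁_tripotent⟩

lemma e₂_mem_J₂ : Δ.e₂ ∈ Δ.J₂ := ⟨Δ.e₂, Δ.e₂_tripotent⟩

/-! ### Orthogonality of `J₁` and `J₂` -/

lemma tri_e₁_e₁_of_mem_M {m : J} (hm : m ∈ Δ.M) : T.tri Δ.e₁ Δ.e₁ m = m :=
  (T.mem_peirce₁ _ _).1 hm.1

lemma tri_e₂_e₂_of_mem_M {m : J} (hm : m ∈ Δ.M) : T.tri Δ.e₂ Δ.e₂ m = m :=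
  (T.mem_peirce₁ _ _).1 hm.2

lemma tri_e₁_e₁_of_mem_J₁ {x : J} (hx : x ∈ Δ.J₁) : T.tri Δ.e₁ Δ.e₁ x = x + x :=
  T.tri_peirce₂ Δ.e₁_tripotent hx

lemma P_e₁_of_mem_M {m : J} (hm : m ∈ Δ.M) : T.P Δ.e₁ m = 0 :=
  T.P_peirce₁ Δ.e₁_tripotent hm.1

lemma P_e₂_of_mem_M {m : J} (hm : m ∈ Δ.M) : T.P Δ.e₂ m = 0 :=
  T.P_peirce₁ Δ.e₂_tripotent hm.2

lemma P_e₁_of_mem_J₂ {x : J} (hx : x ∈ Δ.J₂) : T.P Δ.e₁ x = 0 :=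
  T.P_orth Δ.e₂_tripotent Δ.e₁_tripotent Δ.e₁_mem_zero Δ.e₂_mem_zero hx

lemma tri_J₂_e₁ {x : J} (hx : x ∈ Δ.J₂) (z : J) : T.tri x Δ.e₁ z = 0 :=
  T.tri_orth_left Δ.e₁_tripotent Δ.e₁_mem_zero Δ.e₂_mem_zero hx z

lemma tri_e₁_J₂ {x : J} (hx : x ∈ Δ.J₂) (z : J) : T.tri Δ.e₁ x z = 0 :=
  T.tri_orth_mid Δ.e₁_tripotent Δ.e₁_mem_zero Δ.e₂_mem_zero hx z

/-- `{J₁, J₂, J} = 0`. -/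
lemma tri_J₁_J₂ {x y : J} (hx : x ∈ Δ.J₁) (hy : y ∈ Δ.J₂) (z : J) : T.tri x y z = 0 := by
  obtain ⟨w, rfl⟩ := hx
  have h := T.jp7 Δ.e₁ w y z
  rwa [Δ.P_e₁_of_mem_J₂ hy, tri_zero_left, T.tri_comm w, Δ.tri_J₂_e₁ hy, tri_zero_mid,
    add_zero] at h

lemma tri_J₂_J₁ {x y : J} (hx : x ∈ Δ.J₁) (hy : y ∈ Δ.J₂) (z : J) : T.tri y x z = 0 :=
  Δ.swap.tri_J₁_J₂ hy hx z

lemma P_J₁_J₂ {x y : J} (hx : x ∈ Δ.J₁) (hy : y ∈ Δ.J₂) : T.P x y = 0 := by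
  obtain ⟨w, rfl⟩ := hx
  rw [T.jp3, Δ.P_e₁_of_mem_J₂ hy, map_zero, map_zero]

lemma P_J₁_M {x m : J} (hx : x ∈ Δ.J₁) (hm : m ∈ Δ.M) : T.P x m = 0 := by
  obtain ⟨w, rfl⟩ := hx
  rw [T.jp3, Δ.P_e₁_of_mem_M hm, map_zero, map_zero]

lemma P_e_of_mem_J₁ {x : J} (hx : x ∈ Δ.J₁) : T.P Δ.e x = T.P Δ.e₁ x := by
  have h1 : T.tri Δ.e₂ x Δ.e₁ = 0 := Δ.swap.tri_e₁_J₂ hx _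
  have h2 : T.P Δ.e₂ x = 0 := Δ.swap.P_e₁_of_mem_J₂ hx
  rw [e, P_add, T.tri_comm, h1, h2, add_zero, add_zero]

lemma P_e_of_mem_M {m : J} (hm : m ∈ Δ.M) : T.P Δ.e m = T.tri Δ.e₁ m Δ.e₂ := by
  rw [e, P_add, Δ.P_e₁_of_mem_M hm, Δ.P_e₂_of_mem_M hm, zero_add, add_zero]

lemma P_e₁_P_e₁ {x : J} (hx : x ∈ Δ.J₁) : T.P Δ.e₁ (T.P Δ.e₁ x) = x := by
  obtain ⟨w, rfl⟩ := hx
  exact T.P_sq_of_tripotent Δ.e₁_tripotent w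

lemma P_e_e₁ : T.P Δ.e Δ.e₁ = Δ.e₁ := by
  rw [Δ.P_e_of_mem_J₁ Δ.e₁_mem_J₁]; exact Δ.e₁_tripotent

lemma P_e_e₂ : T.P Δ.e Δ.e₂ = Δ.e₂ := by
  rw [← swap_e]; exact Δ.swap.P_e_e₁

lemma P_e_u : T.P Δ.e Δ.u = Δ.u := by
  rw [Δ.P_e_of_mem_M Δ.u_mem_M, Δ.tri_e₁_u_e₂]

lemma P_e_mem_J₁ {x : J} (hx : x ∈ Δ.J₁) : T.P Δ.e x ∈ Δ.J₁ := by
  rw [Δ.P_e_of_mem_J₁ hx]; exact ⟨_, rfl⟩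

lemma P_e_mem_J₂ {x : J} (hx : x ∈ Δ.J₂) : T.P Δ.e x ∈ Δ.J₂ := by
  rw [← swap_e]; exact Δ.swap.P_e_mem_J₁ hx

lemma P_e_P_e_of_mem_J₁ {x : J} (hx : x ∈ Δ.J₁) : T.P Δ.e (T.P Δ.e x) = x := by
  rw [Δ.P_e_of_mem_J₁ (Δ.P_e_mem_J₁ hx), Δ.P_e_of_mem_J₁ hx, Δ.P_e₁_P_e₁ hx]

lemma tri_e₁_e₁_e₂ : T.tri Δ.e₁ Δ.e₁ Δ.e₂ = 0 := ((T.mem_peirce₀ _ _).1 Δ.e₂_mem_zero).1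

lemma P_e_P_e_of_mem_M {m : J} (hm : m ∈ Δ.M) : T.P Δ.e (T.P Δ.e m) = m := by
  rw [Δ.P_e_of_mem_M (Δ.P_e_mem_M hm), Δ.P_e_of_mem_M hm]
  have h := T.tri_tri_mid Δ.e₁ Δ.e₁ m Δ.e₂ Δ.e₂
  rwa [tri_e₁_e₁_e₂, tri_zero_mid, add_zero, Δ.tri_J₁_J₂ Δ.e₁_mem_J₁ Δ.e₂_mem_J₂,
    tri_zero_left, add_zero, Δ.tri_e₁_e₁_of_mem_M hm, T.tri_comm m, Δ.tri_e₂_e₂_of_mem_M hm] at h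

lemma P_u_mem_J₂ {x : J} (hx : x ∈ Δ.J₁) : T.P Δ.u x ∈ Δ.J₂ := by
  have h1 : ∀ z, T.P Δ.e₁ z = T.P Δ.u (T.P Δ.e₂ (T.P Δ.u z)) := fun z => by
    rw [← T.jp3, Δ.P_u_e₂]
  have h2 : ∀ z, T.P Δ.e₂ z = T.P Δ.u (T.P Δ.e₁ (T.P Δ.u z)) := fun z => by
    rw [← T.jp3, Δ.P_u_e₁]
  obtain ⟨y, rfl⟩ := hx
  refine ⟨T.P Δ.u y, ?_⟩
  rw [h2, h1 (T.P Δ.u (T.P Δ.u y)), T.P_sq_of_tripotent Δ.u_tripotent, ← h1]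

/-! ### The Peirce decomposition -/

variable {Δ}

lemma IsTriangulating.exists_eq (h : Δ.IsTriangulating) (x : J) :
    ∃ x₁ ∈ Δ.J₁, ∃ m ∈ Δ.M, ∃ x₂ ∈ Δ.J₂, x = x₁ + m + x₂ := by
  have hx : x ∈ ⨆ i, (![Δ.J₁, Δ.M, Δ.J₂]) i := by rw [h.2]; trivial
  have : ⨆ i, (![Δ.J₁, Δ.M, Δ.J₂]) i = Δ.J₁ ⊔ Δ.M ⊔ Δ.J₂ := by
    rw [← Finset.sup_univ_eq_iSup]
    simp [Fin.univ_succ, sup_assoc]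
  rw [this] at hx
  obtain ⟨y, hy, x₂, h2, rfl⟩ := Submodule.mem_sup.1 hx
  obtain ⟨x₁, h1, m, hm, rfl⟩ := Submodule.mem_sup.1 hy
  exact ⟨x₁, h1, m, hm, x₂, h2, rfl⟩

lemma IsTriangulating.eq_zero (h : Δ.IsTriangulating) {x₁ m x₂ : J} (h1 : x₁ ∈ Δ.J₁)
    (hm : m ∈ Δ.M) (h2 : x₂ ∈ Δ.J₂) (h0 : x₁ + m + x₂ = 0) : x₁ = 0 ∧ m = 0 ∧ x₂ = 0 := by
  have hi := h.1
  rw [iSupIndep_iff_finsetSum_eq_zero_imp_eq_zero] at hi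
  have := hi Finset.univ ![x₁, m, x₂] (by
    intro i _; fin_cases i <;> assumption) (by simpa [Fin.sum_univ_three] using h0)
  exact ⟨this 0 (Finset.mem_univ _), this 1 (Finset.mem_univ _), this 2 (Finset.mem_univ _)⟩

lemma IsTriangulating.eq_of_eq (h : Δ.IsTriangulating) {x₁ m x₂ y₁ n y₂ : J} (h1 : x₁ ∈ Δ.J₁)
    (hm : m ∈ Δ.M) (h2 : x₂ ∈ Δ.J₂) (h1' : y₁ ∈ Δ.J₁) (hn : n ∈ Δ.M) (h2' : y₂ ∈ Δ.J₂)
    (h0 : x₁ + m + x₂ = y₁ + n + y₂) : x₁ = y₁ ∧ m = n ∧ x₂ = y₂ := by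
  have := h.eq_zero (Submodule.sub_mem _ h1 h1') (Submodule.sub_mem _ hm hn)
    (Submodule.sub_mem _ h2 h2') (by rw [← sub_eq_zero.2 h0]; abel)
  simpa only [sub_eq_zero] using this

lemma IsTriangulating.of_exists_eq
    (hex : ∀ x : J, ∃ x₁ ∈ Δ.J₁, ∃ m ∈ Δ.M, ∃ x₂ ∈ Δ.J₂, x = x₁ + m + x₂)
    (h0 : ∀ x₁ ∈ Δ.J₁, ∀ m ∈ Δ.M, ∀ x₂ ∈ Δ.J₂, x₁ + m + x₂ = 0 → x₁ = 0 ∧ m = 0 ∧ x₂ = 0) :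
    Δ.IsTriangulating := by
  refine ⟨?_, ?_⟩
  · rw [iSupIndep_iff_finsetSum_eq_zero_imp_eq_zero]
    intro s v hv hs i hi
    set w : Fin 3 → J := fun i => if i ∈ s then v i else 0 with hw
    have hmem : ∀ i, w i ∈ ![Δ.J₁, Δ.M, Δ.J₂] i := fun i => by
      by_cases his : i ∈ s
      · simpa [hw, his] using hv i his
      · simp [hw, his]
    have hsum : w 0 + w 1 + w 2 = 0 := by
      rw [← Fin.sum_univ_three w, ← hs]
      simp [hw, Finset.sum_ite_mem]
    obtain ⟨a, b, c⟩ := h0 _ (hmem 0) _ (hmem 1) _ (hmem 2) hsum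
    have : w i = 0 := by fin_cases i <;> assumption
    simpa [hw, hi] using this
  · rw [eq_top_iff]
    rintro x -
    obtain ⟨x₁, h1, m, hm, x₂, h2, rfl⟩ := hex x
    exact Submodule.add_mem _ (Submodule.add_mem _
      (Submodule.mem_iSup_of_mem (p := ![Δ.J₁, Δ.M, Δ.J₂]) 0 h1)
      (Submodule.mem_iSup_of_mem (p := ![Δ.J₁, Δ.M, Δ.J₂]) 1 hm))
      (Submodule.mem_iSup_of_mem (p := ![Δ.J₁, Δ.M, Δ.J₂]) 2 h2)

lemma IsTriangulating.swap (h : Δ.IsTriangulating) : Δ.swap.IsTriangulating := by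
  refine .of_exists_eq (fun x => ?_) (fun x₁ h1 m hm x₂ h2 h0 => ?_)
  · obtain ⟨x₁, h1, m, hm, x₂, h2, rfl⟩ := h.exists_eq x
    exact ⟨x₂, h2, m, Δ.mem_swap_M hm, x₁, h1, by abel⟩
  · obtain ⟨a, b, c⟩ := h.eq_zero h2 (Δ.swap.mem_swap_M hm) h1 (by rw [← h0]; abel)
    exact ⟨c, b, a⟩

/-! ### The automorphism `P(e)P(u)` -/

/-- The endomorphism `P(e)P(u)` of `J`, the extension of `x₂ ↦ x₂*` to all of `J`. -/
def τ (Δ : T.Triangle) : Module.End k J := T.P Δ.e ∘ₗ T.P Δ.u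

lemma τ_apply (Δ : T.Triangle) (x : J) : Δ.τ x = T.P Δ.e (T.P Δ.u x) := rfl

lemma τ_e₁ (Δ : T.Triangle) : Δ.τ Δ.e₁ = Δ.e₂ := by
  rw [τ_apply, Δ.P_u_e₁, Δ.P_e_e₂]

lemma τ_e₂ (Δ : T.Triangle) : Δ.τ Δ.e₂ = Δ.e₁ := by
  rw [τ_apply, Δ.P_u_e₂, Δ.P_e_e₁]

lemma τ_u (Δ : T.Triangle) : Δ.τ Δ.u = Δ.u := by
  rw [τ_apply, show T.P Δ.u Δ.u = Δ.u from Δ.u_tripotent, Δ.P_e_u]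

lemma tri_u_u_e₁ (Δ : T.Triangle) : T.tri Δ.u Δ.u Δ.e₁ = Δ.e₁ + Δ.e₁ := by
  have h := T.jp7 Δ.u Δ.e₁ Δ.e₂ Δ.e₁
  rw [Δ.P_u_e₁, Δ.P_u_e₂, Δ.tri_e₁_u_e₂, T.tri_comm Δ.e₂ Δ.e₂, Δ.tri_J₁_J₂ Δ.e₁_mem_J₁ Δ.e₂_mem_J₂,
    T.tri_eee Δ.e₁_tripotent, zero_add] at h
  exact h.symm

/-- `{u e₁ z} = {e₂ u z}`. With its mirror image, it moves `u` to the middle position. -/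
lemma tri_u_e₁ (Δ : T.Triangle) (z : J) : T.tri Δ.u Δ.e₁ z = T.tri Δ.e₂ Δ.u z := by
  have h := T.jp8 Δ.u Δ.e₂ Δ.u z
  have h2 : T.tri Δ.u Δ.u Δ.e₂ = Δ.e₂ + Δ.e₂ := Δ.swap.tri_u_u_e₁
  rw [Δ.P_u_e₂, h2, show T.P Δ.u Δ.u = Δ.u from Δ.u_tripotent, tri_add_left] at h
  exact (add_right_cancel h).symm

lemma tri_u_e₂ (Δ : T.Triangle) (z : J) : T.tri Δ.u Δ.e₂ z = T.tri Δ.e₁ Δ.u z :=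
  Δ.swap.tri_u_e₁ z

lemma P_u_P_e_P_u (Δ : T.Triangle) (x : J) : T.P Δ.u (T.P Δ.e (T.P Δ.u x)) = T.P Δ.e x := by
  have := T.jp3 Δ.u Δ.e x
  rw [← this]
  congr 2
  rw [e, map_add, Δ.P_u_e₁, Δ.P_u_e₂, add_comm]

namespace IsTriangulating

lemma P_e_P_e (h : Δ.IsTriangulating) (x : J) : T.P Δ.e (T.P Δ.e x) = x := by
  obtain ⟨x₁, h1, m, hm, x₂, h2, rfl⟩ := h.exists_eq x
  have h3 := Δ.swap.P_e_P_e_of_mem_J₁ h2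
  rw [swap_e] at h3
  simp only [map_add, Δ.P_e_P_e_of_mem_J₁ h1, Δ.P_e_P_e_of_mem_M hm, h3]

lemma P_u_P_u (h : Δ.IsTriangulating) (x : J) : T.P Δ.u (T.P Δ.u x) = x := by
  have h1 := Δ.P_u_P_e_P_u (T.P Δ.e x)
  rw [h.P_e_P_e] at h1
  rw [← h1, T.P_sq_of_tripotent Δ.u_tripotent]

lemma P_e_P_u (h : Δ.IsTriangulating) (x : J) : T.P Δ.e (T.P Δ.u x) = T.P Δ.u (T.P Δ.e x) := by
  rw [← Δ.P_u_P_e_P_u x, h.P_u_P_u]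

lemma P_e_P (h : Δ.IsTriangulating) (x y : J) : T.P Δ.e (T.P x y) = T.P (T.P Δ.e x) (T.P Δ.e y) :=
  T.P_P_of_involutive h.P_e_P_e x y

lemma P_e_tri (h : Δ.IsTriangulating) (x y z : J) :
    T.P Δ.e (T.tri x y z) = T.tri (T.P Δ.e x) (T.P Δ.e y) (T.P Δ.e z) :=
  T.tri_of_involutive h.P_e_P_e x y z

lemma τ_τ (h : Δ.IsTriangulating) (x : J) : Δ.τ (Δ.τ x) = x := by
  rw [τ_apply, τ_apply, h.P_e_P_u, h.P_e_P_e, h.P_u_P_u]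

lemma τ_P (h : Δ.IsTriangulating) (x y : J) : Δ.τ (T.P x y) = T.P (Δ.τ x) (Δ.τ y) := by
  simp only [τ_apply, T.P_P_of_involutive h.P_u_P_u, h.P_e_P]

lemma τ_tri (h : Δ.IsTriangulating) (x y z : J) :
    Δ.τ (T.tri x y z) = T.tri (Δ.τ x) (Δ.τ y) (Δ.τ z) := by
  simp only [τ_apply, T.tri_of_involutive h.P_u_P_u, h.P_e_tri]

lemma τ_P_e (h : Δ.IsTriangulating) (x : J) : Δ.τ (T.P Δ.e x) = T.P Δ.e (Δ.τ x) := by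
  simp only [τ_apply, ← h.P_e_P_u]

end IsTriangulating

/-! ### Peirce multiplication rules -/

/-- In a triangulated system, the Peirce `0`-space of `e₂` lies in `J₁`. -/
lemma mem_J₁_of_mem_peirce₀ (h : Δ.IsTriangulating) {w : J} (hD : T.tri Δ.e₂ Δ.e₂ w = 0)
    (hP : T.P Δ.e₂ w = 0) : w ∈ Δ.J₁ := by
  obtain ⟨x₁, h1, m, hm, x₂, h2, rfl⟩ := h.exists_eq w
  have e1 : T.P Δ.e₂ x₁ = 0 := Δ.swap.P_e₁_of_mem_J₂ h1
  have e2 : T.P Δ.e₂ (T.P Δ.e₂ x₂) = x₂ := Δ.swap.P_e₁_P_e₁ h2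
  have e3 : T.tri Δ.e₂ Δ.e₂ x₂ = x₂ + x₂ := Δ.swap.tri_e₁_e₁_of_mem_J₁ h2
  rw [map_add, map_add, e1, Δ.P_e₂_of_mem_M hm, zero_add, zero_add] at hP
  rw [hP, map_zero] at e2
  rw [tri_add_right, tri_add_right, T.tri_comm _ _ x₁, Δ.tri_J₁_J₂ h1 Δ.e₂_mem_J₂,
    Δ.tri_e₂_e₂_of_mem_M hm, ← e2, tri_zero_right, zero_add, add_zero] at hD
  simpa [← e2, hD] using h1

/-- In a triangulated system, the Peirce `1`-space of `e₁` lies in `M`. -/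
lemma mem_M_of_tri (h : Δ.IsTriangulating) {w : J} (hD : T.tri Δ.e₁ Δ.e₁ w = w) : w ∈ Δ.M := by
  obtain ⟨x₁, h1, m, hm, x₂, h2, rfl⟩ := h.exists_eq w
  rw [tri_add_right, tri_add_right, Δ.tri_e₁_e₁_of_mem_J₁ h1, Δ.tri_e₁_e₁_of_mem_M hm,
    T.tri_comm _ _ x₂, Δ.tri_J₂_J₁ Δ.e₁_mem_J₁ h2] at hD
  obtain ⟨ha, -, hb⟩ := h.eq_of_eq (Δ.J₁.add_mem h1 h1) hm Δ.J₂.zero_mem h1 hm h2 hD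
  rw [← hb, add_eq_left.1 ha]
  simpa using hm

lemma tri_M_e₂_M_mem_J₁ (h : Δ.IsTriangulating) {m n : J} (hm : m ∈ Δ.M) (hn : n ∈ Δ.M) :
    T.tri m Δ.e₂ n ∈ Δ.J₁ := by
  apply mem_J₁_of_mem_peirce₀ h
  · have := T.tri_tri Δ.e₂ Δ.e₂ m Δ.e₂ n
    rw [T.tri_eee Δ.e₂_tripotent, Δ.tri_e₂_e₂_of_mem_M hm, Δ.tri_e₂_e₂_of_mem_M hn,
      tri_add_mid] at this
    exact add_eq_right.1 this
  · have := T.tri_P Δ.e₂ m Δ.e₂ n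
    rwa [Δ.P_e₂_of_mem_M hn, tri_zero_right, tri_self, Δ.P_e₂_of_mem_M hm, zero_add, zero_add,
      tri_zero_left] at this

/-- `J₁` is an inner ideal. -/
lemma P_mem_J₁ {x : J} (hx : x ∈ Δ.J₁) (y : J) : T.P x y ∈ Δ.J₁ := by
  obtain ⟨z, rfl⟩ := hx
  exact ⟨T.P z (T.P Δ.e₁ y), (T.jp3 _ _ _).symm⟩

lemma tri_mem_J₁ {x z : J} (hx : x ∈ Δ.J₁) (hz : z ∈ Δ.J₁) (y : J) : T.tri x y z ∈ Δ.J₁ :=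
  sub_mem (sub_mem (P_mem_J₁ (add_mem hx hz) y) (P_mem_J₁ hx y)) (P_mem_J₁ hz y)

lemma P_M_J₂_mem_J₁ (h : Δ.IsTriangulating) {m y : J} (hm : m ∈ Δ.M) (hy : y ∈ Δ.J₂) :
    T.P m y ∈ Δ.J₁ := by
  apply mem_J₁_of_mem_peirce₀ h
  · have := T.tri_P Δ.e₂ Δ.e₂ m y
    rw [T.tri_peirce₂ Δ.e₂_tripotent hy, Δ.tri_e₂_e₂_of_mem_M hm, tri_self, map_add] at this
    exact add_eq_right.1 this
  · obtain ⟨z, rfl⟩ := hy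
    rw [← T.jp3, Δ.P_e₂_of_mem_M hm]
    simp

lemma P_M_M_mem_M (h : Δ.IsTriangulating) {m n : J} (hm : m ∈ Δ.M) (hn : n ∈ Δ.M) :
    T.P m n ∈ Δ.M := by
  apply mem_M_of_tri h
  have := T.tri_P Δ.e₁ Δ.e₁ m n
  rw [Δ.tri_e₁_e₁_of_mem_M hm, Δ.tri_e₁_e₁_of_mem_M hn, tri_self] at this
  exact add_right_cancel this

lemma τ_mem_J₂ {x : J} (hx : x ∈ Δ.J₁) : Δ.τ x ∈ Δ.J₂ :=
  Δ.P_e_mem_J₂ (Δ.P_u_mem_J₂ hx)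

lemma τ_mem_M (h : Δ.IsTriangulating) {m : J} (hm : m ∈ Δ.M) : Δ.τ m ∈ Δ.M := by
  apply mem_M_of_tri h
  have := h.τ_tri Δ.e₂ Δ.e₂ m
  rw [Δ.tri_e₂_e₂_of_mem_M hm, Δ.τ_e₂] at this
  exact this.symm

/-! ### The action of `J₁` on `M` -/

/-- `{P(e)x, e₁, z} = {e₁ x z}` for `x ∈ J₁`. -/
lemma tri_P_e_left (Δ : T.Triangle) {x : J} (hx : x ∈ Δ.J₁) (z : J) :
    T.tri (T.P Δ.e x) Δ.e₁ z = T.tri Δ.e₁ x z := by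
  have := T.jp7 Δ.e₁ x Δ.e₁ z
  rw [T.tri_comm x, Δ.tri_e₁_e₁_of_mem_J₁ hx, tri_add_mid,
    show T.P Δ.e₁ Δ.e₁ = Δ.e₁ from Δ.e₁_tripotent] at this
  rw [Δ.P_e_of_mem_J₁ hx]
  exact add_right_cancel this

/-- `L(x)u` is fixed by `τ`, so that `L(x)` and `τL(x)τ` agree on `u`. -/
lemma τ_tri_e₁_u (h : Δ.IsTriangulating) {x : J} (hx : x ∈ Δ.J₁) :
    Δ.τ (T.tri x Δ.e₁ Δ.u) = T.tri x Δ.e₁ Δ.u := by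
  have h1 : T.P Δ.e (T.tri x Δ.e₁ Δ.u) = T.tri Δ.e₁ x Δ.u := by
    rw [h.P_e_tri, Δ.P_e_e₁, Δ.P_e_u, Δ.tri_P_e_left hx]
  have h2 : T.P Δ.u (T.tri x Δ.e₁ Δ.u) = T.tri Δ.e₁ x Δ.u := by
    have := T.jp1 Δ.u x Δ.e₂
    change T.tri _ _ _ = T.P _ (T.tri _ _ _) at this
    rw [T.tri_comm x, Δ.tri_u_e₁, T.tri_comm Δ.e₂, ← this, Δ.P_u_e₂, T.tri_comm]
  rw [τ_apply, h2, ← h1, h.P_e_P_e]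

/-- The action `m ↦ {x e₁ m}` of `J₁` commutes with the action `m ↦ {y e₂ m}` of `J₂`. -/
lemma tri_e₁_tri_e₂_comm {x y : J} (hx : x ∈ Δ.J₁) (hy : y ∈ Δ.J₂) (m : J) :
    T.tri x Δ.e₁ (T.tri y Δ.e₂ m) = T.tri y Δ.e₂ (T.tri x Δ.e₁ m) := by
  have := T.tri_tri x Δ.e₁ y Δ.e₂ m
  have h1 : T.tri Δ.e₁ x Δ.e₂ = 0 := by
    rw [T.tri_comm]; exact Δ.swap.tri_e₁_J₂ hx _
  rwa [h1, tri_zero_mid, add_zero, T.tri_comm x Δ.e₁ y, Δ.tri_J₂_e₁ hy, tri_zero_left,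
    zero_add] at this

/-- `{y, P(e)x, m} = L(y)L(x)m`. -/
lemma tri_J₁_P_e_M (Δ : T.Triangle) {x y m : J} (hx : x ∈ Δ.J₁) (hm : m ∈ Δ.M) :
    T.tri y (T.P Δ.e x) m = T.tri y Δ.e₁ (T.tri x Δ.e₁ m) := by
  have := T.jp8 m x Δ.e₁ y
  rw [Δ.P_e₁_of_mem_M hm, tri_zero_mid, add_zero, ← Δ.P_e_of_mem_J₁ hx] at this
  rw [T.tri_comm y, ← this, T.tri_comm _ _ y, T.tri_comm m]

/-- `L({x e₁ y}) = L(x)L(y) + L(y)L(x)`. -/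
lemma tri_tri_e₁_e₁ {x y m : J} (hx : x ∈ Δ.J₁) (hy : y ∈ Δ.J₁) (hm : m ∈ Δ.M) :
    T.tri (T.tri x Δ.e₁ y) Δ.e₁ m =
      T.tri x Δ.e₁ (T.tri y Δ.e₁ m) + T.tri y Δ.e₁ (T.tri x Δ.e₁ m) := by
  rw [T.jp8, ← Δ.P_e_of_mem_J₁ hx, ← Δ.P_e_of_mem_J₁ hy, Δ.tri_J₁_P_e_M hx hm, Δ.tri_J₁_P_e_M hy hm]

/-- `L(P(x)P(e)y) = L(x)L(y)L(x)`. -/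
lemma tri_P_P_e_e₁ (h : Δ.IsTriangulating) {x y m : J} (hx : x ∈ Δ.J₁) (hy : y ∈ Δ.J₁)
    (hm : m ∈ Δ.M) :
    T.tri (T.P x (T.P Δ.e y)) Δ.e₁ m =
      T.tri x Δ.e₁ (T.tri y Δ.e₁ (T.tri x Δ.e₁ m)) := by
  have h1 := T.jp7 x (T.P Δ.e y) Δ.e₁ m
  have hxy := Δ.tri_mem_M hy hm
  have h2 : T.tri (T.P Δ.e y) x Δ.e₁ = T.P Δ.e (T.tri x Δ.e₁ y) := by
    rw [h.P_e_tri, Δ.P_e_e₁, Δ.tri_P_e_left hx, T.tri_comm]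
  have h3 : T.tri (T.P x Δ.e₁) (T.P Δ.e y) m =
      T.tri x Δ.e₁ (T.tri x Δ.e₁ (T.tri y Δ.e₁ m)) := by
    have h5 : T.tri (T.P x Δ.e₁) Δ.e₁ (T.tri y Δ.e₁ m) = _ := T.jp2 x Δ.e₁ (T.tri y Δ.e₁ m)
    rw [Δ.tri_J₁_P_e_M hy hm, h5, ← Δ.P_e_of_mem_J₁ hx]
    exact Δ.tri_J₁_P_e_M hx hxy
  rw [h2, h3, Δ.tri_J₁_P_e_M (tri_mem_J₁ hx hy _) hm, tri_tri_e₁_e₁ hx hy hm, tri_add_right] at h1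
  rw [add_comm (T.tri x Δ.e₁ (T.tri x _ _))] at h1
  exact add_right_cancel h1

/-! ### The form `{m e₂ n}` on `M` -/

/-- `{m, P(e)y, n} = {{y e₂ m} e₂ n}` for `y ∈ J₂`. -/
lemma tri_M_P_e_M {m n y : J} (hm : m ∈ Δ.M) (hy : y ∈ Δ.J₂) :
    T.tri m (T.P Δ.e y) n = T.tri (T.tri y Δ.e₂ m) Δ.e₂ n := by
  have := Δ.swap.tri_J₁_P_e_M (y := n) hy (Δ.mem_swap_M hm)
  rw [swap_e] at this
  rw [T.tri_comm m, this, T.tri_comm]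
  rfl

/-- The action of `J₂` is self-adjoint with respect to `{m e₂ n}`. -/
lemma tri_tri_e₂_comm {m n y : J} (hm : m ∈ Δ.M) (hn : n ∈ Δ.M) (hy : y ∈ Δ.J₂) :
    T.tri (T.tri y Δ.e₂ m) Δ.e₂ n = T.tri m Δ.e₂ (T.tri y Δ.e₂ n) := by
  rw [← tri_M_P_e_M hm hy, T.tri_comm, tri_M_P_e_M hn hy, T.tri_comm]

/-- `{e₁, P(e)n, m} = {n e₂ m}` for `n ∈ M`. -/
lemma tri_e₁_P_e_left {n m : J} (hn : n ∈ Δ.M) :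
    T.tri Δ.e₁ (T.P Δ.e n) m = T.tri n Δ.e₂ m := by
  have := T.tri_tri_mid Δ.e₁ Δ.e₁ n Δ.e₂ m
  rwa [Δ.tri_e₁_e₁_e₂, tri_zero_mid, add_zero, Δ.tri_J₁_J₂ Δ.e₁_mem_J₁ Δ.e₂_mem_J₂,
    tri_zero_left, add_zero, Δ.tri_e₁_e₁_of_mem_M hn, ← Δ.P_e_of_mem_M hn] at this

/-- `{x, P(e)n, z} = {L(x)n, e₂, z}`. -/
lemma tri_J₁_P_e {x n : J} (hx : x ∈ Δ.J₁) (hn : n ∈ Δ.M) (z : J) :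
    T.tri x (T.P Δ.e n) z = T.tri (T.tri x Δ.e₁ n) Δ.e₂ z := by
  have := T.tri_tri_mid x Δ.e₁ n Δ.e₂ z
  have h1 : T.tri Δ.e₁ x Δ.e₂ = 0 := by
    rw [T.tri_comm]; exact Δ.swap.tri_e₁_J₂ hx _
  rwa [h1, tri_zero_mid, add_zero, Δ.tri_J₁_J₂ hx Δ.e₂_mem_J₂, tri_zero_left, add_zero,
    ← Δ.P_e_of_mem_M hn] at this

/-- `t(p)u = p + τ p` for the trace `t(p) = {p e₂ u}`. -/
lemma tri_tri_e₂_u_e₁_u {p : J} (h : Δ.IsTriangulating) (hp : p ∈ Δ.M) :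
    T.tri (T.tri p Δ.e₂ Δ.u) Δ.e₁ Δ.u = p + Δ.τ p := by
  have := T.jp8 p Δ.e₁ Δ.u Δ.e₂
  have hu : T.P Δ.u p ∈ Δ.M := by
    have := Δ.P_e_mem_M (τ_mem_M h hp)
    rwa [τ_apply, h.P_e_P_e] at this
  rw [Δ.P_u_e₁, ← Δ.P_e_of_mem_M hu, T.tri_comm p Δ.e₂ Δ.e₂,
    Δ.tri_e₂_e₂_of_mem_M hp] at this
  rw [T.tri_comm _ Δ.e₁, Δ.tri_u_e₁, T.tri_comm, T.tri_comm p, Δ.tri_u_e₂,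
    T.tri_comm Δ.e₁, this]
  rfl

/-- `P(L(x)m)y = P(x)P(e)P(m)y` for `y ∈ J₂`. -/
lemma P_tri_e₁_J₂ (h : Δ.IsTriangulating) {x m y : J} (hx : x ∈ Δ.J₁) (hm : m ∈ Δ.M)
    (hy : y ∈ Δ.J₂) : T.P (T.tri x Δ.e₁ m) y = T.P x (T.P Δ.e (T.P m y)) := by
  have := T.jp3_lin22 x m Δ.e₁ y
  change T.P (T.tri x Δ.e₁ m) y + T.tri _ _ _ = _ + _ + T.tri _ (T.P _ (T.tri _ _ _)) _ at this
  rwa [Δ.tri_J₁_J₂ (P_mem_J₁ hx _) hy, Δ.tri_J₁_J₂ hx hy, Δ.P_J₁_J₂ hx hy, map_zero, map_zero,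
    tri_zero_mid, add_zero, add_zero, zero_add, ← Δ.P_e_of_mem_J₁ (P_M_J₂_mem_J₁ h hm hy)] at this

/-- `P(m)P(e)n = L({m e₂ n})m - {P(m)e₁, e₂, n}`. -/
lemma P_M_P_e (h : Δ.IsTriangulating) {m n : J} (hm : m ∈ Δ.M) (hn : n ∈ Δ.M) :
    T.P m (T.P Δ.e n) + T.tri (T.P m Δ.e₁) Δ.e₂ n =
      T.tri (T.tri m Δ.e₂ n) Δ.e₁ m := by
  have h1 := T.jp8 Δ.e₁ (T.P Δ.e n) m Δ.e₂
  have hbm := Δ.P_e_mem_M hm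
  have h2 : T.tri Δ.e₁ m (T.P Δ.e n) = T.P Δ.e (T.tri m Δ.e₂ n) := by
    rw [← tri_e₁_P_e_left hm, h.P_e_tri, h.P_e_P_e, Δ.P_e_e₁]
  have hB := tri_M_e₂_M_mem_J₁ h hm hn
  have h3 : T.tri (T.P Δ.e (T.tri m Δ.e₂ n)) m Δ.e₂ =
      T.P Δ.e (T.tri (T.tri m Δ.e₂ n) Δ.e₁ m) := by
    have h4 := tri_J₁_P_e (Δ.P_e_mem_J₁ hB) hbm Δ.e₂
    rw [h.P_e_P_e, T.tri_comm _ Δ.e₂ Δ.e₂,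
      Δ.tri_e₂_e₂_of_mem_M (Δ.tri_mem_M (Δ.P_e_mem_J₁ hB) hbm)] at h4
    rw [h4, h.P_e_tri _ Δ.e₁ m, Δ.P_e_e₁]
  have hy : T.P m Δ.e₁ ∈ Δ.J₂ := P_M_J₂_mem_J₁ h.swap (Δ.mem_swap_M hm) Δ.e₁_mem_J₁
  have h5 : T.tri (T.P Δ.e n) (T.P m Δ.e₁) Δ.e₂ =
      T.P Δ.e (T.tri (T.P m Δ.e₁) Δ.e₂ n) := by
    have h6 := Δ.swap.tri_P_e_left hy (T.P Δ.e n)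
    rw [swap_e] at h6
    rw [T.tri_comm, h.P_e_tri, Δ.P_e_e₂]
    exact h6.symm
  rw [h2, h3, h5, ← Δ.P_e_of_mem_M (P_M_M_mem_M h hm (Δ.P_e_mem_M hn)), ← map_add] at h1
  rw [← h.P_e_P_e (T.tri _ _ m), h1, h.P_e_P_e]

/-- `{m u p} = L(t(m))p + L(t(p))m - {u e₂ {m e₁ p}}` for the trace `t(m) = {m e₂ u}`. -/
lemma tri_M_u_M (Δ : T.Triangle) (m p : J) :
    T.tri Δ.u Δ.e₂ (T.tri m Δ.e₁ p) + T.tri m Δ.u p =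
      T.tri (T.tri m Δ.e₂ Δ.u) Δ.e₁ p + T.tri (T.tri p Δ.e₂ Δ.u) Δ.e₁ m := by
  have := T.tri_tri Δ.e₁ Δ.u m Δ.e₁ p
  rw [T.tri_comm Δ.u Δ.e₁ Δ.e₁, Δ.tri_e₁_e₁_of_mem_M Δ.u_mem_M, ← Δ.tri_u_e₂, ← Δ.tri_u_e₂,
    ← Δ.tri_u_e₂] at this
  rw [this, T.tri_comm m _ (T.tri _ _ _), T.tri_comm m Δ.e₂, T.tri_comm p Δ.e₂]

/-- The commutation rule of `{m u -}` and `L(x)` on `M`. -/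
lemma tri_M_u_tri (h : Δ.IsTriangulating) {m x p : J} (hm : m ∈ Δ.M) (hx : x ∈ Δ.J₁)
    (hp : p ∈ Δ.M) :
    T.tri m Δ.u (T.tri x Δ.e₁ p) + T.tri x Δ.e₁ (T.tri (T.tri m Δ.e₂ Δ.u) Δ.e₁ p) =
      T.tri (T.tri (T.tri x Δ.e₁ Δ.u) Δ.e₂ m) Δ.e₁ p + T.tri x Δ.e₁ (T.tri m Δ.u p) := by
  have := T.tri_tri m Δ.u x Δ.e₁ p
  have h1 : T.tri Δ.u m Δ.e₁ = T.P Δ.e (T.tri m Δ.e₂ Δ.u) := by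
    rw [← tri_e₁_P_e_left hm, h.P_e_tri, h.P_e_P_e, Δ.P_e_e₁, Δ.P_e_u, T.tri_comm]
  have h2 := tri_J₁_P_e hx Δ.u_mem_M m
  rw [Δ.P_e_u] at h2
  rwa [h1, Δ.tri_J₁_P_e_M (tri_M_e₂_M_mem_J₁ h hm Δ.u_mem_M) hp, T.tri_comm m Δ.u x, h2] at this

/-! ### The algebra `C` -/

/-- The restriction of `τ` to `M`. -/
def τM (h : Δ.IsTriangulating) : Module.End k Δ.M :=
  Δ.τ.restrict (fun _ hm => τ_mem_M h hm)

/-- The symmetric form `(m, n) ↦ {m e₂ n}` on `M` with values in `J₁`. -/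
def form (h : Δ.IsTriangulating) (m n : Δ.M) : Δ.J₁ :=
  ⟨T.tri m Δ.e₂ n, tri_M_e₂_M_mem_J₁ h m.2 n.2⟩

/-- The trace `t : M → J₁`, `t(m) = {m e₂ u}`. -/
def trace (h : Δ.IsTriangulating) : Δ.M →ₗ[k] Δ.J₁ where
  toFun m := form h m Δ.uM
  map_add' _ _ := Subtype.ext (T.tri_add_left _ _ _ _)
  map_smul' _ _ := Subtype.ext (T.tri_smul_left _ _ _ _)

lemma coe_τM (h : Δ.IsTriangulating) (m : Δ.M) : (τM h m : J) = Δ.τ m := rfl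

lemma coe_L (x : Δ.J₁) (m : Δ.M) : (Δ.L x m : J) = T.tri x Δ.e₁ m := rfl

lemma coe_form (h : Δ.IsTriangulating) (m n : Δ.M) : (form h m n : J) = T.tri m Δ.e₂ n := rfl

lemma coe_trace (h : Δ.IsTriangulating) (m : Δ.M) : (trace h m : J) = T.tri m Δ.e₂ Δ.u := rfl

lemma trace_apply (h : Δ.IsTriangulating) (m : Δ.M) : trace h m = form h m Δ.uM := rfl

lemma coe_LC (x : Δ.J₁) : (Δ.LC x : Module.End k Δ.M) = Δ.L x := rfl

lemma coe_uM : (Δ.uM : J) = Δ.u := rfl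

lemma form_comm (h : Δ.IsTriangulating) (m n : Δ.M) : form h m n = form h n m :=
  Subtype.ext (T.tri_comm _ _ _)

lemma τM_τM (h : Δ.IsTriangulating) (m : Δ.M) : τM h (τM h m) = m :=
  Subtype.ext (h.τ_τ m)

lemma τM_uM (h : Δ.IsTriangulating) : τM h Δ.uM = Δ.uM :=
  Subtype.ext Δ.τ_u

lemma barM_barM (h : Δ.IsTriangulating) (m : Δ.M) : Δ.barM (Δ.barM m) = m :=
  Subtype.ext (h.P_e_P_e m)

lemma barM_uM : Δ.barM Δ.uM = Δ.uM :=
  Subtype.ext Δ.P_e_u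

lemma L_e₁ : Δ.L ⟨Δ.e₁, Δ.e₁_mem_J₁⟩ = 1 :=
  LinearMap.ext fun m => Subtype.ext (Δ.tri_e₁_e₁_of_mem_M m.2)

lemma LC_e₁ : Δ.LC ⟨Δ.e₁, Δ.e₁_mem_J₁⟩ = 1 := Subtype.ext L_e₁

/-- Conjugation by `τ` turns the action of `x ∈ J₁` into that of `τx ∈ J₂`. -/
lemma coe_τM_L_τM (h : Δ.IsTriangulating) (x : Δ.J₁) (m : Δ.M) :
    (τM h (Δ.L x (τM h m)) : J) = T.tri (Δ.τ x) Δ.e₂ m := by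
  rw [coe_τM, coe_L, coe_τM, h.τ_tri, h.τ_τ, τ_e₁]

lemma τM_L_uM (h : Δ.IsTriangulating) (x : Δ.J₁) : τM h (Δ.L x Δ.uM) = Δ.L x Δ.uM :=
  Subtype.ext (τ_tri_e₁_u h x.2)

lemma L_trace_uM (h : Δ.IsTriangulating) (m : Δ.M) :
    Δ.L (trace h m) Δ.uM = m + τM h m :=
  Subtype.ext (tri_tri_e₂_u_e₁_u h m.2)

/-- `C` commutes with `τ C τ`, the algebra generated by the action of `J₂` on `M`. -/
lemma conj_comm (h : Δ.IsTriangulating) (c d : Δ.C) (m : Δ.M) :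
    (c : Module.End k Δ.M) (τM h ((d : Module.End k Δ.M) (τM h m))) =
      τM h ((d : Module.End k Δ.M) (τM h ((c : Module.End k Δ.M) m))) := by
  obtain ⟨c, hc⟩ := c
  obtain ⟨d, hd⟩ := d
  change c (τM h (d (τM h m))) = τM h (d (τM h (c m)))
  induction hc using Algebra.adjoin_induction generalizing m with
  | mem c hc =>
    obtain ⟨x, rfl⟩ := hc
    induction hd using Algebra.adjoin_induction generalizing m with
    | mem d hd =>
      obtain ⟨y, rfl⟩ := hd
      apply Subtype.ext
      rw [coe_L, coe_τM_L_τM, coe_τM_L_τM, coe_L]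
      exact tri_e₁_tri_e₂_comm x.2 (τ_mem_J₂ y.2) m
    | algebraMap r =>
      simp only [Module.algebraMap_end_apply, map_smul, τM_τM]
    | add d d' _ _ h1 h2 => simp only [LinearMap.add_apply, map_add, h1, h2]
    | mul d d' _ _ h1 h2 =>
      have := h2 m
      rw [Module.End.mul_apply, Module.End.mul_apply, ← τM_τM h (d' (τM h m)), h1, h2, τM_τM]
  | algebraMap r => simp only [Module.algebraMap_end_apply, map_smul]
  | add c c' _ _ h1 h2 => simp only [LinearMap.add_apply, map_add, h1, h2]
  | mul c c' _ _ h1 h2 => simp only [Module.End.mul_apply, h1, h2]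

/-- The elements of `C` are linear combinations of the products `L(x₁) ⋯ L(xₙ)`. -/
lemma C_induction {p : Δ.C → Prop} (word : ∀ l : List Δ.J₁, p (l.map Δ.LC).prod)
    (add : ∀ c d, p c → p d → p (c + d)) (smul : ∀ (a : k) c, p c → p (a • c)) (c : Δ.C) :
    p c := by
  have hmul : ∀ l : List (Module.End k Δ.M), (∀ y ∈ l, y ∈ Set.range Δ.L) →
      ∃ l' : List Δ.J₁, l = l'.map Δ.L := by
    intro l hl
    induction l with
    | nil => exact ⟨[], rfl⟩
    | cons y l ih =>
      obtain ⟨l', rfl⟩ := ih fun z hz => hl z (List.mem_cons_of_mem _ hz)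
      obtain ⟨x, rfl⟩ := hl y List.mem_cons_self
      exact ⟨x :: l', rfl⟩
  obtain ⟨c, hc⟩ := c
  have hc' := hc
  change c ∈ Subalgebra.toSubmodule (Algebra.adjoin k (Set.range Δ.L)) at hc'
  rw [Algebra.adjoin_eq_span] at hc'
  suffices key : ∃ hc : c ∈ Δ.C, p ⟨c, hc⟩ from key.2
  clear hc
  induction hc' using Submodule.span_induction with
  | mem c hc =>
    obtain ⟨l, hl, rfl⟩ := Submonoid.exists_list_of_mem_closure hc
    obtain ⟨l', rfl⟩ := hmul l hl
    have : (l'.map Δ.L).prod = ((l'.map Δ.LC).prod : Δ.C) := by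
      rw [← Subalgebra.coe_val, map_list_prod, List.map_map]
      rfl
    rw [this]
    exact ⟨_, word l'⟩
  | zero =>
    refine ⟨Δ.C.zero_mem, ?_⟩
    have := smul 0 _ (word [])
    rwa [zero_smul] at this
  | add c d _ _ h1 h2 => exact ⟨_, add _ _ h1.2 h2.2⟩
  | smul a c _ h1 => exact ⟨_, smul a _ h1.2⟩

/-! ### Reversal of products `L(x₁) ⋯ L(xₙ)` -/

/-- `τL(x)τ` is self-adjoint with respect to `{m e₂ n}`. -/
lemma form_conj_L (h : Δ.IsTriangulating) (x : Δ.J₁) (m n : Δ.M) :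
    form h (τM h (Δ.L x (τM h m))) n = form h m (τM h (Δ.L x (τM h n))) := by
  apply Subtype.ext
  simp only [coe_form, coe_τM_L_τM]
  exact tri_tri_e₂_comm m.2 n.2 (τ_mem_J₂ x.2)

/-- `c^π u = τ(cu)` for a product `c = L(x₁) ⋯ L(xₙ)` with reversal `c^π`. -/
lemma reverse_word_uM (h : Δ.IsTriangulating) (l : List Δ.J₁) :
    ((l.map Δ.LC).reverse.prod : Δ.C).1 Δ.uM = τM h (((l.map Δ.LC).prod : Δ.C).1 Δ.uM) := by
  induction l with
  | nil => exact (τM_uM h).symm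
  | cons x l ih =>
    simp only [List.map_cons, List.reverse_cons, List.prod_append, List.prod_cons,
      List.prod_nil, mul_one, MulMemClass.coe_mul, Module.End.mul_apply, coe_LC] at ih ⊢
    have := conj_comm h (l.map Δ.LC).reverse.prod (Δ.LC x) Δ.uM
    rw [τM_uM, coe_LC, τM_L_uM, ih, τM_τM] at this
    exact this

/-- The adjoint of `τcτ` with respect to `{m e₂ n}` is `τc^πτ`, for a product
`c = L(x₁) ⋯ L(xₙ)` with reversal `c^π`. -/
lemma form_conj_word (h : Δ.IsTriangulating) (l : List Δ.J₁) (m n : Δ.M) :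
    form h (τM h (((l.map Δ.LC).prod : Δ.C).1 (τM h m))) n =
      form h m (τM h (((l.map Δ.LC).reverse.prod : Δ.C).1 (τM h n))) := by
  induction l generalizing m n with
  | nil => simp [τM_τM]
  | cons x l ih =>
    simp only [List.map_cons, List.reverse_cons, List.prod_append, List.prod_cons,
      List.prod_nil, mul_one, MulMemClass.coe_mul, Module.End.mul_apply, coe_LC] at ih ⊢
    have := form_conj_L h x (τM h (((l.map Δ.LC).prod : Δ.C).1 (τM h m))) n
    rw [τM_τM] at this
    rw [this, ih, τM_τM]

/-- `L(t(cu)) = c + c^π` for the reversal `c` of a product `c^π = L(x₁) ⋯ L(xₙ)`.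

This is the identity behind the reversal involution. The induction step from `c` to `c L(x)`
compares two expressions for `{cu, u, L(x)p}`, using that `{cu, u, p} = cp + τc^πτp`. -/
lemma L_trace_word (h : Δ.IsTriangulating) (l : List Δ.J₁) :
    Δ.LC (trace h (((l.map Δ.LC).reverse.prod : Δ.C).1 Δ.uM)) =
      (l.map Δ.LC).reverse.prod + (l.map Δ.LC).prod := by
  induction l with
  | nil =>
    have : trace h Δ.uM = ⟨Δ.e₁, Δ.e₁_mem_J₁⟩ + ⟨Δ.e₁, Δ.e₁_mem_J₁⟩ := by
      apply Subtype.ext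
      rw [coe_trace, coe_uM, Δ.tri_u_e₂, T.tri_comm]
      exact Δ.tri_u_u_e₁
    apply Subtype.ext
    simp only [List.map_nil, List.reverse_nil, List.prod_nil, OneMemClass.coe_one,
      Module.End.one_apply, this, coe_LC, map_add, L_e₁, AddMemClass.coe_add]
  | cons x l ih =>
    have hu := reverse_word_uM h l
    have hform := form_conj_word h l
    have hcomm := conj_comm h (l.map Δ.LC).reverse.prod (Δ.LC x) Δ.uM
    have hconj := conj_comm h
    rw [τM_uM, coe_LC, τM_L_uM] at hcomm
    simp only [List.map_cons, List.reverse_cons, List.prod_append, List.prod_cons,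
      List.prod_nil, mul_one]
    generalize (l.map Δ.LC).reverse.prod = c at *
    generalize (l.map Δ.LC).prod = d at *
    have ih' : ∀ p, Δ.L (trace h (c.1 Δ.uM)) p = c.1 p + d.1 p := fun p =>
      congrArg (fun c : Δ.C => c.1 p) ih
    -- `{cu, u, p} = cp + τdτp`, from the two traces in `tri_M_u_M`
    have hV : ∀ p : Δ.M, T.tri (c.1 Δ.uM : Δ.M) Δ.u p = c.1 p + τM h (d.1 (τM h p)) := by
      intro p
      have h1 := Δ.tri_M_u_M (c.1 Δ.uM) (p : J)
      have h2 : Δ.L (trace h p) (c.1 Δ.uM) = τM h (d.1 (τM h p)) + τM h (d.1 p) := by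
        have := hconj (Δ.LC (trace h p)) d Δ.uM
        rwa [τM_uM, ← hu, coe_LC, L_trace_uM, map_add, τM_τM, map_add, map_add] at this
      have h3 : T.tri Δ.u Δ.e₂ (T.tri (c.1 Δ.uM : Δ.M) Δ.e₁ p) =
          (τM h (d.1 p) + d.1 p : Δ.M) := by
        have e1 : Δ.τ (T.tri (c.1 Δ.uM : Δ.M) Δ.e₁ p) = trace h (τM h (d.1 p)) := by
          have := hform (τM h p) Δ.uM
          rw [τM_τM, τM_uM, form_comm h (τM h p)] at this
          rw [h.τ_tri, τ_e₁, trace_apply, this]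
          rfl
        have e2 := L_trace_uM h (τM h (d.1 p))
        rw [τM_τM] at e2
        rw [← e2, ← τM_L_uM, coe_τM, coe_L, ← e1, h.τ_tri, h.τ_τ, τ_e₁, coe_uM, τ_u, T.tri_comm]
        exact h
      change _ = (Δ.L (trace h (c.1 Δ.uM)) p : J) + (Δ.L (trace h p) (c.1 Δ.uM) : J) at h1
      rw [h3, ih', h2] at h1
      simp only [Submodule.coe_add] at h1
      rw [← sub_eq_zero] at h1 ⊢
      rw [← h1]
      abel
    apply Subtype.ext
    ext p : 1
    apply Subtype.ext
    have h1 := tri_M_u_tri h (c.1 Δ.uM).2 x.2 p.2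
    have h2 : trace h (c.1 (Δ.L x Δ.uM)) = form h (Δ.L x Δ.uM) (c.1 Δ.uM) := by
      have := form_conj_L h x Δ.uM (c.1 Δ.uM)
      rw [τM_uM, τM_L_uM, ← hcomm] at this
      rw [this, trace_apply, form_comm]
    have h3 := hconj (Δ.LC x) d p
    change T.tri _ _ (Δ.L x p : J) + (Δ.L x (Δ.L (trace h (c.1 Δ.uM)) p) : J) =
      (Δ.L (form h (Δ.L x Δ.uM) (c.1 Δ.uM)) p : J) + _ at h1
    have h4 : T.tri x Δ.e₁ (T.tri (c.1 Δ.uM : Δ.M) Δ.u p) =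
        (Δ.L x (c.1 p + τM h (d.1 (τM h p))) : Δ.M) := by
      rw [hV]; rfl
    rw [hV, h4, ih', ← h2] at h1
    rw [coe_LC] at h3
    rw [map_add, map_add, h3] at h1
    change (Δ.L (trace h (c.1 (Δ.L x Δ.uM))) p : J) = (c.1 (Δ.L x p) + Δ.L x (d.1 p) : Δ.M)
    simp only [Submodule.coe_add] at h1 ⊢
    rw [← sub_eq_zero] at h1 ⊢
    rw [← neg_eq_zero, ← h1]
    abel

/-! ### The reversal involution of `C` -/

/-- The reversal involution of `C`. The formula `c ↦ L(t(cu)) - c` makes it well defined without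
reference to a presentation of `c` by products; that it reverses products is `L_trace_word`. -/
def rev (h : Δ.IsTriangulating) : Δ.C →ₗ[k] Δ.C where
  toFun c := Δ.LC (trace h (c.1 Δ.uM)) - c
  map_add' c d := by
    rw [Subalgebra.coe_add, LinearMap.add_apply, map_add, map_add]
    abel
  map_smul' a c := by
    rw [Subalgebra.coe_smul, LinearMap.smul_apply, map_smul, map_smul, RingHom.id_apply]
    exact (smul_sub a (Δ.LC (trace h (c.1 Δ.uM))) c).symm

lemma rev_apply (h : Δ.IsTriangulating) (c : Δ.C) :
    rev h c = Δ.LC (trace h (c.1 Δ.uM)) - c := rfl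

lemma LC_trace (h : Δ.IsTriangulating) (c : Δ.C) :
    Δ.LC (trace h (c.1 Δ.uM)) = c + rev h c := by
  rw [rev_apply]; abel

lemma isReversal_rev (h : Δ.IsTriangulating) : Δ.IsReversal (rev h) := by
  intro l
  have := L_trace_word h l.reverse
  rw [List.map_reverse, List.reverse_reverse] at this
  rw [rev_apply, this]
  abel

lemma rev_LC (h : Δ.IsTriangulating) (x : Δ.J₁) : rev h (Δ.LC x) = Δ.LC x := by
  simpa using isReversal_rev h [x]

lemma rev_one (h : Δ.IsTriangulating) : rev h 1 = 1 := by
  simpa using isReversal_rev h []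

lemma rev_rev (h : Δ.IsTriangulating) (c : Δ.C) : rev h (rev h c) = c := by
  induction c using C_induction with
  | word l =>
    rw [isReversal_rev, ← List.map_reverse, isReversal_rev, List.map_reverse, List.reverse_reverse]
  | add c d hc hd => rw [map_add, map_add, hc, hd]
  | smul a c hc => rw [map_smul, map_smul, hc]

lemma rev_mul (h : Δ.IsTriangulating) (c d : Δ.C) : rev h (c * d) = rev h d * rev h c := by
  induction c using C_induction with
  | word l =>
    induction d using C_induction with
    | word l' =>
      rw [← List.prod_append, ← List.map_append, isReversal_rev, isReversal_rev, isReversal_rev,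
        List.map_append, List.reverse_append, List.prod_append]
    | add c d hc hd => rw [mul_add, map_add, map_add, hc, hd, add_mul]
    | smul a c hc => rw [mul_smul_comm, map_smul, map_smul, hc, smul_mul_assoc]
  | add c d hc hd => rw [add_mul, map_add, map_add, hc, hd, mul_add]
  | smul a c hc => rw [smul_mul_assoc, map_smul, map_smul, hc, mul_smul_comm]

lemma rev_uM (h : Δ.IsTriangulating) (c : Δ.C) :
    (rev h c).1 Δ.uM = τM h (c.1 Δ.uM) := by
  induction c using C_induction with
  | word l => rw [isReversal_rev]; exact reverse_word_uM h l
  | add c d hc hd => simp [map_add, hc, hd]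
  | smul a c hc => simp [map_smul, hc]

lemma conj_uM (h : Δ.IsTriangulating) (c : Δ.C) :
    τM h (c.1 (τM h Δ.uM)) = (rev h c).1 Δ.uM := by
  rw [rev_uM, τM_uM]

lemma form_add_left (h : Δ.IsTriangulating) (m m' n : Δ.M) :
    form h (m + m') n = form h m n + form h m' n := Subtype.ext (T.tri_add_left _ _ _ _)

lemma form_smul_left (h : Δ.IsTriangulating) (a : k) (m n : Δ.M) :
    form h (a • m) n = a • form h m n := Subtype.ext (T.tri_smul_left _ _ _ _)

lemma form_add_right (h : Δ.IsTriangulating) (m n n' : Δ.M) :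
    form h m (n + n') = form h m n + form h m n' := Subtype.ext (T.tri_add_right _ _ _ _)

lemma form_smul_right (h : Δ.IsTriangulating) (a : k) (m n : Δ.M) :
    form h m (a • n) = a • form h m n := Subtype.ext (T.tri_smul_right _ _ _ _)

/-- The adjoint of `τcτ` with respect to `{m e₂ n}` is `τc^πτ`. -/
lemma form_conj (h : Δ.IsTriangulating) (c : Δ.C) (m n : Δ.M) :
    form h (τM h (c.1 (τM h m))) n = form h m (τM h ((rev h c).1 (τM h n))) := by
  induction c using C_induction with
  | word l => rw [isReversal_rev]; exact form_conj_word h l m n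
  | add c d hc hd =>
    simp only [map_add, Subalgebra.coe_add, LinearMap.add_apply, form_add_left, form_add_right,
      hc, hd]
  | smul a c hc =>
    simp only [map_smul, Subalgebra.coe_smul, LinearMap.smul_apply, form_smul_left,
      form_smul_right, hc]

/-- `L({cu, e₂, du}) = c d^π + d c^π`. -/
lemma LC_form (h : Δ.IsTriangulating) (c d : Δ.C) :
    Δ.LC (form h (c.1 Δ.uM) (d.1 Δ.uM)) = c * rev h d + d * rev h c := by
  have h1 := form_conj h d (c.1 Δ.uM) Δ.uM
  have h2 := conj_comm h c d Δ.uM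
  rw [conj_uM, rev_rev] at h1
  rw [conj_uM] at h2
  rw [← h1, ← h2, ← trace_apply]
  have := LC_trace h (c * rev h d)
  rwa [rev_mul, rev_rev] at this

/-! ### Conjugation of `C` by `P(e)` -/

/-- The map `x ↦ P(e)x` on `J₁`. -/
def bar₁ (Δ : T.Triangle) : Δ.J₁ →ₗ[k] Δ.J₁ :=
  (T.P Δ.e).restrict (fun _ hx => Δ.P_e_mem_J₁ hx)

lemma bar₁_bar₁ (h : Δ.IsTriangulating) (x : Δ.J₁) : Δ.bar₁ (Δ.bar₁ x) = x :=
  Subtype.ext (h.P_e_P_e x)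

lemma barM_L (h : Δ.IsTriangulating) (x : Δ.J₁) (m : Δ.M) :
    Δ.barM (Δ.L x m) = Δ.L (Δ.bar₁ x) (Δ.barM m) := by
  apply Subtype.ext
  change T.P _ (T.tri _ _ _) = _
  rw [h.P_e_tri, P_e_e₁]
  rfl

/-- The automorphism `c ↦ P(e)cP(e)` of `End(M)`. -/
def barEnd (h : Δ.IsTriangulating) : Module.End k Δ.M ≃ₐ[k] Module.End k Δ.M :=
  (LinearEquiv.ofInvolutive Δ.barM (barM_barM h)).conjAlgEquiv k

lemma barEnd_apply (h : Δ.IsTriangulating) (c : Module.End k Δ.M) (m : Δ.M) :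
    barEnd h c m = Δ.barM (c (Δ.barM m)) := rfl

lemma barEnd_L (h : Δ.IsTriangulating) (x : Δ.J₁) : barEnd h (Δ.L x) = Δ.L (Δ.bar₁ x) :=
  LinearMap.ext fun m => by rw [barEnd_apply, barM_L h, barM_barM h]

lemma barEnd_mem_C (h : Δ.IsTriangulating) (c : Δ.C) : barEnd h c.1 ∈ Δ.C := by
  have : Δ.C ≤ Δ.C.comap (barEnd h).toAlgHom := by
    refine Algebra.adjoin_le ?_
    rintro _ ⟨x, rfl⟩
    change barEnd h (Δ.L x) ∈ Δ.C
    rw [barEnd_L]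
    exact (Δ.LC _).2
  exact this c.2

/-- The automorphism `c ↦ P(e)cP(e)` of `C`. -/
def barC (h : Δ.IsTriangulating) : Δ.C →ₐ[k] Δ.C :=
  ((barEnd h).toAlgHom.comp Δ.C.val).codRestrict Δ.C (barEnd_mem_C h)

lemma barC_apply (h : Δ.IsTriangulating) (c : Δ.C) (m : Δ.M) :
    (barC h c).1 m = Δ.barM (c.1 (Δ.barM m)) := rfl

lemma barC_LC (h : Δ.IsTriangulating) (x : Δ.J₁) : barC h (Δ.LC x) = Δ.LC (Δ.bar₁ x) :=
  Subtype.ext (barEnd_L h x)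

lemma barC_barC (h : Δ.IsTriangulating) (c : Δ.C) : barC h (barC h c) = c := by
  apply Subtype.ext
  ext m : 1
  rw [barC_apply, barC_apply, barM_barM h, barM_barM h]

lemma barC_uM (h : Δ.IsTriangulating) (c : Δ.C) :
    (barC h c).1 Δ.uM = Δ.barM (c.1 Δ.uM) := by
  rw [barC_apply, barM_uM]

lemma rev_barC (h : Δ.IsTriangulating) (c : Δ.C) : rev h (barC h c) = barC h (rev h c) := by
  induction c using C_induction with
  | word l =>
    have hl : ∀ l : List Δ.J₁, barC h (l.map Δ.LC).prod = ((l.map Δ.bar₁).map Δ.LC).prod :=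
      fun l => by
        rw [map_list_prod, List.map_map, List.map_map]
        congr 2
        ext x : 1
        exact barC_LC h x
    rw [hl, isReversal_rev, isReversal_rev, ← List.map_reverse, ← List.map_reverse,
      ← List.map_reverse, hl]
  | add c d hc hd => simp only [map_add, hc, hd]
  | smul a c hc => simp only [map_smul, hc]

/-! ### The quadratic map on `Cu` -/

lemma P_τ (h : Δ.IsTriangulating) (c : Δ.C) (y : J) :
    Δ.τ (T.P (c.1 Δ.uM : Δ.M) y) = T.P ((rev h c).1 Δ.uM : Δ.M) (Δ.τ y) := by
  rw [h.τ_P, rev_uM]; rfl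

/-- The element `P(m)y` of `J₁`, for `m ∈ M` and `y ∈ J₂`. -/
def PM (h : Δ.IsTriangulating) (m : Δ.M) (y : Δ.J₂) : Δ.J₁ :=
  ⟨T.P m y, P_M_J₂_mem_J₁ h m.2 y.2⟩

/-- The linearization of `LC_PM` below, through which the formula passes from products
`L(x₁) ⋯ L(xₙ)` to their linear combinations. -/
lemma LC_PM_add (h : Δ.IsTriangulating) (c d : Δ.C) (y : Δ.J₂) :
    Δ.LC (PM h ((c + d : Δ.C).1 Δ.uM) y) = Δ.LC (PM h (c.1 Δ.uM) y) +
      (c * Δ.LC (Δ.bar₁ (Δ.star y)) * rev h d + d * Δ.LC (Δ.bar₁ (Δ.star y)) * rev h c) +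
      Δ.LC (PM h (d.1 Δ.uM) y) := by
  set x := Δ.bar₁ (Δ.star y) with hx
  have h1 : PM h ((c + d : Δ.C).1 Δ.uM) y = PM h (c.1 Δ.uM) y +
      form h ((c * Δ.LC x).1 Δ.uM) (d.1 Δ.uM) + PM h (d.1 Δ.uM) y := by
    apply Subtype.ext
    change T.P ((c.1 Δ.uM : J) + (d.1 Δ.uM : J)) y = T.P _ _ + T.tri _ _ _ + T.P _ _
    rw [P_add]
    congr 2
    have h2 := tri_M_P_e_M (n := (d.1 Δ.uM : J)) (c.1 Δ.uM).2 (Δ.P_e_mem_J₂ y.2)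
    rw [h.P_e_P_e] at h2
    have h3 : T.tri (T.P Δ.e y) Δ.e₂ (c.1 Δ.uM : Δ.M) = ((c * Δ.LC x).1 Δ.uM : Δ.M) := by
      have h4 := coe_τM_L_τM h x (c.1 Δ.uM)
      have h5 : Δ.τ x = T.P Δ.e y := by
        change Δ.τ (T.P Δ.e (Δ.τ y)) = _
        rw [h.τ_P_e, h.τ_τ]
      rw [h5] at h4
      have h6 := conj_comm h c (Δ.LC x) Δ.uM
      rw [conj_uM, rev_LC, coe_LC] at h6
      rw [← h4, ← h6]
      rfl
    rw [h2, h3]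
  rw [h1, map_add, map_add, LC_form, rev_mul, rev_LC, mul_assoc d]

/-- `L(P(cu)y) = c L(P(e)y*) c^π` for `y ∈ J₂`. -/
lemma LC_PM (h : Δ.IsTriangulating) (c : Δ.C) (y : Δ.J₂) :
    Δ.LC (PM h (c.1 Δ.uM) y) = c * Δ.LC (Δ.bar₁ (Δ.star y)) * rev h c := by
  induction c using C_induction with
  | word l =>
    induction l with
    | nil =>
      have : PM h Δ.uM y = Δ.bar₁ (Δ.star y) := by
        apply Subtype.ext
        change T.P Δ.u y = T.P Δ.e (T.P Δ.e (T.P Δ.u y))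
        rw [h.P_e_P_e]
      simp [rev_one, this]
    | cons x l ih =>
      have h1 : PM h ((Δ.LC x * (l.map Δ.LC).prod).1 Δ.uM) y =
          ⟨T.P x (T.P Δ.e (PM h ((l.map Δ.LC).prod.1 Δ.uM) y)), P_mem_J₁ x.2 _⟩ :=
        Subtype.ext (P_tri_e₁_J₂ h x.2 ((l.map Δ.LC).prod.1 Δ.uM).2 y.2)
      have h2 : ∀ z : Δ.J₁, Δ.LC ⟨T.P x (T.P Δ.e z), P_mem_J₁ x.2 _⟩ =
          Δ.LC x * Δ.LC z * Δ.LC x := by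
        intro z
        apply Subtype.ext
        ext m : 1
        exact Subtype.ext (tri_P_P_e_e₁ h x.2 z.2 m.2)
      rw [List.map_cons, List.prod_cons, h1, h2, ih, rev_mul, rev_LC]
      simp only [mul_assoc]
  | add c d hc hd =>
    rw [LC_PM_add, hc, hd, map_add]
    noncomm_ring
  | smul a c hc =>
    have : PM h ((a • c : Δ.C).1 Δ.uM) y = (a * a) • PM h (c.1 Δ.uM) y := by
      apply Subtype.ext
      change T.P (a • (c.1 Δ.uM : J)) y = (a * a) • T.P (c.1 Δ.uM : Δ.M) y
      rw [QuadraticMap.map_smul]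
      rfl
    rw [this, map_smul, hc, map_smul]
    simp [mul_smul]

/-! ### The product of `J_h` -/

/-- `{z, e₂, cu} = (c L(z*))u`: the action of `J₂` on `Cu` is right multiplication on `C`. -/
lemma coe_LC_uM_star (h : Δ.IsTriangulating) (z : Δ.J₂) (c : Δ.C) :
    (T.tri z Δ.e₂ (c.1 Δ.uM : Δ.M) : J) = ((c * Δ.LC (Δ.star z)).1 Δ.uM : Δ.M) := by
  have h1 := coe_τM_L_τM h (Δ.star z) (c.1 Δ.uM)
  have h2 := conj_comm h c (Δ.LC (Δ.star z)) Δ.uM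
  have h3 : Δ.τ (Δ.star z) = z := h.τ_τ z
  rw [h3] at h1
  rw [conj_uM, rev_LC, coe_LC] at h2
  rw [← h1, ← h2]
  rfl

lemma coe_uM_eq_P_e (h : Δ.IsTriangulating) (d : Δ.C) :
    (d.1 Δ.uM : J) = T.P Δ.e ((barC h d).1 Δ.uM : Δ.M) := by
  rw [barC_uM]
  exact (h.P_e_P_e _).symm

/-- `{x, du, z} = {L(x)(P(e)dP(e))u, e₂, z}`. -/
lemma tri_J₁_C (h : Δ.IsTriangulating) (x : Δ.J₁) (d : Δ.C) (z : J) :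
    T.tri x (d.1 Δ.uM : Δ.M) z = T.tri ((Δ.LC x * barC h d).1 Δ.uM : Δ.M) Δ.e₂ z := by
  rw [coe_uM_eq_P_e h d]
  exact tri_J₁_P_e x.2 ((barC h d).1 Δ.uM).2 z

/-- `{x y m} = L(x)L(P(e)y)m`. -/
lemma tri_J₁_J₁_M (h : Δ.IsTriangulating) (x y : Δ.J₁) (m : Δ.M) :
    T.tri x y m = (Δ.L x (Δ.L (Δ.bar₁ y) m) : J) := by
  have := Δ.tri_J₁_P_e_M (y := x) (Δ.bar₁ y).2 m.2
  rw [show T.P Δ.e (Δ.bar₁ y : J) = y from h.P_e_P_e y] at this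
  exact this

/-- `P(cu)du = (c (P(e)dP(e))^π c) u`. -/
lemma P_C_C (h : Δ.IsTriangulating) (c d : Δ.C) :
    T.P (c.1 Δ.uM : Δ.M) (d.1 Δ.uM : Δ.M) = ((c * rev h (barC h d) * c).1 Δ.uM : J) := by
  rw [coe_uM_eq_P_e h d]
  set D := barC h d
  have h1 := P_M_P_e h (c.1 Δ.uM).2 (D.1 Δ.uM).2
  have h2 : T.tri (T.tri (c.1 Δ.uM : Δ.M) Δ.e₂ (D.1 Δ.uM : Δ.M)) Δ.e₁ (c.1 Δ.uM : Δ.M) =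
      (((c * rev h D + D * rev h c) * c).1 Δ.uM : J) := by
    rw [← LC_form]; rfl
  have hy : T.P (c.1 Δ.uM : Δ.M) Δ.e₁ ∈ Δ.J₂ :=
    P_M_J₂_mem_J₁ h.swap (Δ.mem_swap_M (c.1 Δ.uM).2) Δ.e₁_mem_J₁
  -- `P(cu)e₁ ∈ J₂` acts on `Cu` as right multiplication by `L((P(cu)e₁)*) = c^π c`
  have h3 : T.tri (T.P (c.1 Δ.uM : Δ.M) Δ.e₁) Δ.e₂ (D.1 Δ.uM : Δ.M) =
      ((D * (rev h c * c)).1 Δ.uM : J) := by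
    have h4 : Δ.star ⟨_, hy⟩ = PM h ((rev h c).1 Δ.uM) ⟨Δ.e₂, Δ.e₂_mem_J₂⟩ := by
      apply Subtype.ext
      change Δ.τ (T.P _ _) = T.P _ _
      rw [P_τ, τ_e₁]
    have h5 : Δ.bar₁ (Δ.star ⟨Δ.e₂, Δ.e₂_mem_J₂⟩) = ⟨Δ.e₁, Δ.e₁_mem_J₁⟩ := by
      apply Subtype.ext
      change T.P _ (Δ.τ _) = _
      rw [τ_e₂, P_e_e₁]
    have := coe_LC_uM_star h ⟨_, hy⟩ D
    rw [h4, LC_PM, rev_rev, h5, LC_e₁, mul_one] at this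
    exact this
  have h7 : (c * rev h D + D * rev h c) * c = c * rev h D * c + D * (rev h c * c) := by
    noncomm_ring
  rw [h2, h3, h7] at h1
  exact add_right_cancel h1

/-- The `J₁`-component of `P(x + cu + z)(y + du + w)`. -/
def P₁₁ (h : Δ.IsTriangulating) (x : Δ.J₁) (c : Δ.C) (y : Δ.J₁) (d : Δ.C) (w : Δ.J₂) : Δ.J₁ :=
  ⟨T.P x y, P_mem_J₁ x.2 y⟩ + form h ((Δ.LC x * barC h d).1 Δ.uM) (c.1 Δ.uM) +
    PM h (c.1 Δ.uM) w

lemma coe_P₁₁ (h : Δ.IsTriangulating) (x : Δ.J₁) (c : Δ.C) (y : Δ.J₁) (d : Δ.C) (w : Δ.J₂) :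
    (P₁₁ h x c y d w : J) = T.P x y + T.tri x (d.1 Δ.uM : Δ.M) (c.1 Δ.uM : Δ.M) +
      T.P (c.1 Δ.uM : Δ.M) w := by
  rw [tri_J₁_C h]; rfl

lemma LC_P₁₁ (h : Δ.IsTriangulating) (x : Δ.J₁) (c : Δ.C) (y : Δ.J₁) (d : Δ.C) (w : Δ.J₂) :
    Δ.LC (P₁₁ h x c y d w) =
      Δ.LC x * barC h (Δ.LC y) * Δ.LC x + Δ.LC x * barC h d * rev h c +
        c * rev h (barC h d) * Δ.LC x + c * barC h (Δ.LC (Δ.star w)) * rev h c := by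
  have h1 : Δ.LC ⟨T.P x y, P_mem_J₁ x.2 y⟩ = Δ.LC x * barC h (Δ.LC y) * Δ.LC x := by
    rw [barC_LC]
    apply Subtype.ext
    ext m : 1
    have := tri_P_P_e_e₁ h x.2 (Δ.bar₁ y).2 m.2
    rw [show T.P Δ.e (Δ.bar₁ y : J) = y from h.P_e_P_e y] at this
    exact Subtype.ext this
  rw [P₁₁, map_add, map_add, h1, LC_form, LC_PM, rev_mul, rev_LC, barC_LC h (Δ.star w)]
  noncomm_ring

/-- The image under `τ` of an element of `J₁`, as an element of `J₂`. -/
def τ₁ (x : Δ.J₁) : Δ.J₂ := ⟨Δ.τ x, τ_mem_J₂ x.2⟩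

lemma star_τ₁ (h : Δ.IsTriangulating) (x : Δ.J₁) : Δ.star (τ₁ x) = x := Subtype.ext (h.τ_τ x)

/-- The `M`-component of `P(x + cu + z)(y + du + w)`, as the element of `C` to be applied to
`u`. -/
def P₁₂ (h : Δ.IsTriangulating) (x : Δ.J₁) (c : Δ.C) (z : Δ.J₂) (y : Δ.J₁) (d : Δ.C)
    (w : Δ.J₂) : Δ.C :=
  Δ.LC x * barC h (Δ.LC y) * c + c * rev h (barC h d) * c +
    Δ.LC x * barC h d * Δ.LC (Δ.star z) + c * barC h (Δ.LC (Δ.star w)) * Δ.LC (Δ.star z)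

/-- The `J₂`-component of `P(x + cu + z)(y + du + w)`. -/
def P₂₂ (h : Δ.IsTriangulating) (c : Δ.C) (z : Δ.J₂) (y : Δ.J₁) (d : Δ.C)
    (w : Δ.J₂) : Δ.J₂ :=
  τ₁ (P₁₁ h (Δ.star z) (rev h c) (Δ.star w) (rev h d) (τ₁ y))

lemma LC_star_P₂₂ (h : Δ.IsTriangulating) (c : Δ.C) (z : Δ.J₂) (y : Δ.J₁) (d : Δ.C)
    (w : Δ.J₂) :
    Δ.LC (Δ.star (P₂₂ h c z y d w)) =
      Δ.LC (Δ.star z) * barC h (Δ.LC (Δ.star w)) * Δ.LC (Δ.star z) +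
        Δ.LC (Δ.star z) * rev h (barC h d) * c +
        rev h c * barC h d * Δ.LC (Δ.star z) + rev h c * barC h (Δ.LC y) * c := by
  rw [P₂₂, star_τ₁ h, LC_P₁₁, star_τ₁ h, rev_rev, ← rev_barC, rev_rev]

lemma coe_P₂₂ (h : Δ.IsTriangulating) (c : Δ.C) (z : Δ.J₂) (y : Δ.J₁) (d : Δ.C)
    (w : Δ.J₂) : (P₂₂ h c z y d w : J) = T.P z w +
      T.tri z (d.1 Δ.uM : Δ.M) (c.1 Δ.uM : Δ.M) + T.P (c.1 Δ.uM : Δ.M) y := by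
  change Δ.τ (P₁₁ h _ _ _ _ _) = _
  have h1 : ∀ z : Δ.J₂, Δ.τ (Δ.star z) = z := fun z => h.τ_τ z
  have h2 : ∀ c : Δ.C, Δ.τ ((rev h c).1 Δ.uM : Δ.M) = (c.1 Δ.uM : J) := fun c => by
    rw [rev_uM]; exact h.τ_τ _
  have h3 : Δ.τ (τ₁ y : J) = y := h.τ_τ y
  rw [coe_P₁₁, map_add, map_add, h.τ_P, h.τ_P, h.τ_tri, h1, h1, h2, h2, h3]

/-- The product of `J_h`. -/
lemma P_mkJh (h : Δ.IsTriangulating) (x : Δ.J₁) (c : Δ.C) (z : Δ.J₂) (y : Δ.J₁) (d : Δ.C)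
    (w : Δ.J₂) :
    T.P (Δ.mkJh x c z) (Δ.mkJh y d w) =
      (Δ.mkJh (P₁₁ h x c y d w) (P₁₂ h x c z y d w) (P₂₂ h c z y d w) : J) := by
  change T.P (x + (c.1 Δ.uM : J) + z) (y + (d.1 Δ.uM : J) + w) =
    (P₁₁ h x c y d w : J) + ((P₁₂ h x c z y d w).1 Δ.uM : Δ.M) + P₂₂ h c z y d w
  have e1 : T.tri x y (c.1 Δ.uM : Δ.M) = ((Δ.LC x * barC h (Δ.LC y) * c).1 Δ.uM : J) := by
    rw [tri_J₁_J₁_M h, barC_LC]; rfl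
  have e2 : T.tri x (d.1 Δ.uM : Δ.M) z =
      ((Δ.LC x * barC h d * Δ.LC (Δ.star z)).1 Δ.uM : J) := by
    rw [tri_J₁_C h, T.tri_comm, coe_LC_uM_star h]
  have e3 : T.tri (c.1 Δ.uM : Δ.M) w z =
      ((c * barC h (Δ.LC (Δ.star w)) * Δ.LC (Δ.star z)).1 Δ.uM : J) := by
    have h1 := Δ.swap.tri_J₁_P_e_M (y := z) (Δ.P_e_mem_J₂ w.2) (Δ.mem_swap_M (c.1 Δ.uM).2)
    have h2 := coe_LC_uM_star h ⟨_, Δ.P_e_mem_J₂ w.2⟩ c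
    have h3 : Δ.star ⟨_, Δ.P_e_mem_J₂ w.2⟩ = Δ.bar₁ (Δ.star w) :=
      Subtype.ext (h.τ_P_e w)
    rw [swap_e, h.P_e_P_e] at h1
    rw [h3] at h2
    rw [T.tri_comm, h1, barC_LC, ← coe_LC_uM_star h, ← h2]
    rfl
  have z1 : T.P x (d.1 Δ.uM : Δ.M) = 0 := Δ.P_J₁_M x.2 (d.1 Δ.uM).2
  have z2 : T.P x (w : J) = 0 := Δ.P_J₁_J₂ x.2 w.2
  have z3 : T.P z (d.1 Δ.uM : Δ.M) = 0 := Δ.swap.P_J₁_M z.2 (Δ.mem_swap_M (d.1 Δ.uM).2)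
  have z4 : T.P z (y : J) = 0 := Δ.swap.P_J₁_J₂ z.2 y.2
  have z5 : ∀ v, T.tri x w v = 0 := Δ.tri_J₁_J₂ x.2 w.2
  have z6 : ∀ v, T.tri z y v = 0 := Δ.tri_J₂_J₁ y.2 z.2
  have z7 : ∀ v, T.tri v y z = 0 := fun v => by rw [T.tri_comm, z6]
  rw [coe_P₁₁, coe_P₂₂, P₁₂]
  simp only [P_add, map_add, tri_add_left, z1, z2, z3, z4, z5, z7, e1, e2, e3, P_C_C h,
    Subalgebra.coe_add, LinearMap.add_apply, Submodule.coe_add, add_zero, zero_add]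
  rw [T.tri_comm z]
  abel

end Triangle

end JordanTripleSystem

/-! ### Gradings -/

section DirectSum

variable {k M N ι : Type*} [CommRing k] [AddCommGroup M] [Module k M] [AddCommGroup N] [Module k N]

/-- Independence is inherited along injective homogeneous maps of degree `0`. -/
lemma iSupIndep.of_injective {G : ι → Submodule k M} (hG : iSupIndep G) {N' : ι → Submodule k N}
    (f : N →ₗ[k] M) (hf : Function.Injective f) (hfG : ∀ i, ∀ a ∈ N' i, f a ∈ G i) :
    iSupIndep N' := by
  rw [iSupIndep_iff_finsetSum_eq_zero_imp_eq_zero] at hG ⊢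
  intro s v hv h0 i hi
  refine hf ?_
  rw [map_zero]
  exact hG s (fun i => f (v i)) (fun i hi => hfG i _ (hv i hi))
    (by rw [← map_sum, h0, map_zero]) i hi

/-- An injective homogeneous map of degree `0` reflects degrees. -/
lemma mem_of_injective_of_mem {N : Type*} [AddCommMonoid N] [Module k N]
    {G : ι → Submodule k M} (hG : iSupIndep G) {N' : ι → Submodule k N} (hN : ⨆ i, N' i = ⊤)
    (f : N →ₗ[k] M) (hf : Function.Injective f) (hfG : ∀ i, ∀ a ∈ N' i, f a ∈ G i)
    {i : ι} {a : N} (ha : f a ∈ G i) : a ∈ N' i := by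
  classical
  have hmem : a ∈ ⨆ i, N' i := hN ▸ Submodule.mem_top
  obtain ⟨v, hv, rfl⟩ := (Submodule.mem_iSup_iff_exists_finsupp ..).mp hmem
  rw [iSupIndep_iff_finsetSum_eq_imp_eq] at hG
  have hi := hG (insert i v.support) (fun j => f (v j))
    (fun j => if j = i then f (v.sum fun _ x => x) else 0) (fun j _ => ⟨hfG j _ (hv j), by
      split_ifs with h
      · rwa [h]
      · exact Submodule.zero_mem _⟩) (by
      rw [Finset.sum_ite_eq' _ i, if_pos (Finset.mem_insert_self _ _), ← map_sum, Finsupp.sum]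
      congr 1
      exact Finset.sum_insert_of_eq_zero_if_notMem (by simp)) i (Finset.mem_insert_self _ _)
  rw [if_pos rfl] at hi
  rw [← hf hi]
  exact hv i

end DirectSum

namespace JordanTripleSystem

section grading

variable {k J N Λ : Type*} [CommRing k] [AddCommGroup J] [Module k J] [AddCommMonoid N]
  [Module k N] {G : Λ → Submodule k J}

/-- The range of a homogeneous map of degree `0` is a graded submodule. -/
lemma isGradedSubmodule_range {N' : Λ → Submodule k N} (hN : ⨆ i, N' i = ⊤) (f : N →ₗ[k] J)
    (hfG : ∀ i, ∀ a ∈ N' i, f a ∈ G i) : IsGradedSubmodule G (LinearMap.range f) := by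
  refine le_antisymm ?_ (iSup_le fun i => inf_le_left)
  rw [← Submodule.map_top, ← hN, Submodule.map_iSup]
  refine iSup_mono fun i => ?_
  rintro _ ⟨a, ha, rfl⟩
  exact ⟨Submodule.mem_iSup_of_mem i ⟨a, ha, rfl⟩, hfG i a ha⟩

lemma IsGradedSubmodule.sup {S S' : Submodule k J} (h : IsGradedSubmodule G S)
    (h' : IsGradedSubmodule G S') : IsGradedSubmodule G (S ⊔ S') := by
  refine le_antisymm (sup_le ?_ ?_) (iSup_le fun i => inf_le_left)
  · exact h.le.trans (iSup_mono fun i => inf_le_inf_right _ le_sup_left)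
  · exact h'.le.trans (iSup_mono fun i => inf_le_inf_right _ le_sup_right)

/-- A graded submodule is the sum of its homogeneous parts. -/
lemma IsGradedSubmodule.iSup_inducedGrading {S : Submodule k J} (h : IsGradedSubmodule G S) :
    ⨆ i, inducedGrading G S i = ⊤ := by
  apply Submodule.map_injective_of_injective S.injective_subtype
  rw [Submodule.map_iSup, Submodule.map_subtype_top]
  refine (iSup_congr fun i => ?_).trans h.symm
  exact Submodule.map_comap_subtype _ _

lemma IsGrading.restrict [AddCommGroup Λ] {T : JordanTripleSystem k J} (hG : T.IsGrading G)
    {S : Submodule k J} (hS : T.IsSubsystem S) (h : IsGradedSubmodule G S) :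
    (T.restrict S hS).IsGrading (inducedGrading G S) where
  directSum := ⟨hG.directSum.1.of_injective S.subtype S.injective_subtype fun _ _ ha => ha,
    h.iSup_inducedGrading⟩
  P_mem i j x hx y hy := hG.P_mem i j x hx y hy
  tri_mem i j l x hx y hy z hz := hG.tri_mem i j l x hx y hy z hz

end grading

namespace Triangle

variable {k J Λ : Type*} [CommRing k] [AddCommGroup J] [Module k J] [AddCommGroup Λ]
  {T : JordanTripleSystem k J} {Δ : T.Triangle} {G : Λ → Submodule k J}

lemma IsGradedTriangulating.swap (hΔ : Δ.IsGradedTriangulating G) :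
    Δ.swap.IsGradedTriangulating G :=
  ⟨hΔ.1, hΔ.2.swap, hΔ.3, hΔ.5, hΔ.4⟩

lemma P_mem_of_mem_zero (hG : T.IsGrading G) {v : J} (hv : v ∈ G 0) (i : Λ) {x : J}
    (hx : x ∈ G i) : T.P v x ∈ G i := by
  simpa using hG.P_mem 0 i v hv x hx

lemma isGradedSubmodule_J₁ (hΔ : Δ.IsGradedTriangulating G) : IsGradedSubmodule G Δ.J₁ :=
  isGradedSubmodule_range hΔ.1.directSum.2 _ fun i _ ha =>
    P_mem_of_mem_zero hΔ.1 hΔ.e₁_mem i ha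

lemma e_mem (hΔ : Δ.IsGradedTriangulating G) : Δ.e ∈ G 0 :=
  Submodule.add_mem _ hΔ.e₁_mem hΔ.e₂_mem

lemma τ_mem (hΔ : Δ.IsGradedTriangulating G) (i : Λ) {x : J} (hx : x ∈ G i) : Δ.τ x ∈ G i :=
  P_mem_of_mem_zero hΔ.1 (e_mem hΔ) i (P_mem_of_mem_zero hΔ.1 hΔ.u_mem i hx)

lemma LC_mem_gradedC (hΔ : Δ.IsGradedTriangulating G) (i : Λ) {x : Δ.J₁} (hx : (x : J) ∈ G i) :
    Δ.LC x ∈ Δ.gradedC G i := by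
  intro j m hm
  have := hΔ.1.tri_mem i 0 j x hx _ hΔ.e₁_mem m hm
  rwa [add_zero, add_comm] at this

lemma one_mem_gradedC : (1 : Δ.C) ∈ Δ.gradedC G 0 := by
  intro j m hm
  rwa [add_zero]

lemma mul_mem_gradedC {i j : Λ} {c d : Δ.C} (hc : c ∈ Δ.gradedC G i) (hd : d ∈ Δ.gradedC G j) :
    c * d ∈ Δ.gradedC G (i + j) := by
  intro l m hm
  have := hc _ _ (hd l m hm)
  rwa [add_assoc, add_comm j i] at this

/-- `C` is the sum of its homogeneous parts, as it is generated by the homogeneous `L(x)`. -/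
lemma iSup_gradedC (hΔ : Δ.IsGradedTriangulating G) : ⨆ i, Δ.gradedC G i = ⊤ := by
  have hL : ∀ x, Δ.LC x ∈ ⨆ i, Δ.gradedC G i := by
    intro x
    have : (⊤ : Submodule k Δ.J₁) ≤ (⨆ i, Δ.gradedC G i).comap Δ.LC := by
      rw [← (isGradedSubmodule_J₁ hΔ).iSup_inducedGrading]
      exact iSup_le fun i x hx => Submodule.mem_iSup_of_mem i (LC_mem_gradedC hΔ i hx)
    exact this Submodule.mem_top
  have hmul : ∀ c ∈ ⨆ i, Δ.gradedC G i, ∀ d ∈ ⨆ i, Δ.gradedC G i, c * d ∈ ⨆ i, Δ.gradedC G i := by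
    intro c hc d hd
    induction hc using Submodule.iSup_induction' with
    | mem i c hc =>
      induction hd using Submodule.iSup_induction' with
      | mem j d hd => exact Submodule.mem_iSup_of_mem _ (mul_mem_gradedC hc hd)
      | zero => rw [mul_zero]; exact Submodule.zero_mem _
      | add d d' _ _ h1 h2 => rw [mul_add]; exact Submodule.add_mem _ h1 h2
    | zero => rw [zero_mul]; exact Submodule.zero_mem _
    | add c c' _ _ h1 h2 => rw [add_mul]; exact Submodule.add_mem _ h1 h2
  rw [eq_top_iff]
  rintro c -
  induction c using C_induction with
  | word l =>
    induction l with
    | nil => exact Submodule.mem_iSup_of_mem 0 one_mem_gradedC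
    | cons x l ih => rw [List.map_cons, List.prod_cons]; exact hmul _ (hL x) _ ih
  | add c d hc hd => exact Submodule.add_mem _ hc hd
  | smul a c hc => exact Submodule.smul_mem _ a hc

lemma uM_mem_of_mem_gradedC (hΔ : Δ.IsGradedTriangulating G) {i : Λ} {c : Δ.C}
    (hc : c ∈ Δ.gradedC G i) : (c.1 Δ.uM : J) ∈ G i := by
  have := hc 0 Δ.uM hΔ.u_mem
  rwa [zero_add] at this

lemma rev_mem_gradedC (hΔ : Δ.IsGradedTriangulating G) {i : Λ} {c : Δ.C}
    (hc : c ∈ Δ.gradedC G i) : rev hΔ.2 c ∈ Δ.gradedC G i := by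
  refine fun j m hm => (G (j + i)).sub_mem (LC_mem_gradedC hΔ i ?_ j m hm) (hc j m hm)
  have := hΔ.1.tri_mem i 0 0 _ (uM_mem_of_mem_gradedC hΔ hc) _ hΔ.e₂_mem _ hΔ.u_mem
  rwa [add_zero, add_zero] at this

lemma barC_mem_gradedC (hΔ : Δ.IsGradedTriangulating G) {i : Λ} {c : Δ.C}
    (hc : c ∈ Δ.gradedC G i) : barC hΔ.2 c ∈ Δ.gradedC G i := fun j m hm =>
  P_mem_of_mem_zero hΔ.1 (e_mem hΔ) _
    (hc j (Δ.barM m) (P_mem_of_mem_zero hΔ.1 (e_mem hΔ) _ hm))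

lemma Cu_map_eq_range : Δ.Cu.map Δ.M.subtype =
    LinearMap.range (Δ.M.subtype ∘ₗ (LinearMap.applyₗ Δ.uM : Module.End k Δ.M →ₗ[k] Δ.M) ∘ₗ
      Δ.C.val.toLinearMap) := by
  rw [LinearMap.range_comp, LinearMap.range_comp]
  congr 2
  ext m
  simp only [LinearMap.mem_range, Submodule.mem_map]
  exact ⟨fun ⟨c, hc, e⟩ => ⟨c, ⟨⟨c, hc⟩, rfl⟩, e⟩, fun ⟨_, ⟨c, rfl⟩, e⟩ => ⟨_, c.2, e⟩⟩

lemma isGradedSubmodule_Jh (hΔ : Δ.IsGradedTriangulating G) : IsGradedSubmodule G Δ.Jh := by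
  refine ((isGradedSubmodule_J₁ hΔ).sup ?_).sup (isGradedSubmodule_J₁ hΔ.swap)
  rw [Cu_map_eq_range]
  refine isGradedSubmodule_range (iSup_gradedC hΔ) _ fun i c hc => ?_
  exact uM_mem_of_mem_gradedC hΔ hc

/-! ### The subsystem `J_h` -/

lemma exists_mkJh_eq (x : Δ.Jh) : ∃ x₁ c x₂, x = Δ.mkJh x₁ c x₂ := by
  obtain ⟨x, hx⟩ := x
  obtain ⟨y, hy, z, hz, rfl⟩ := Submodule.mem_sup.1 hx
  obtain ⟨w, hw, v, ⟨m, ⟨c, hc, rfl⟩, rfl⟩, rfl⟩ := Submodule.mem_sup.1 hy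
  exact ⟨⟨w, hw⟩, ⟨c, hc⟩, ⟨z, hz⟩, rfl⟩

lemma isSubsystem_Jh (h : Δ.IsTriangulating) : T.IsSubsystem Δ.Jh := by
  intro x hx y hy
  obtain ⟨x₁, c, x₂, e1⟩ := exists_mkJh_eq ⟨x, hx⟩
  obtain ⟨y₁, d, y₂, e2⟩ := exists_mkJh_eq ⟨y, hy⟩
  rw [show x = Δ.mkJh x₁ c x₂ from congrArg Subtype.val e1,
    show y = Δ.mkJh y₁ d y₂ from congrArg Subtype.val e2, P_mkJh h]
  exact SetLike.coe_mem _

lemma J₁_le_Jh : Δ.J₁ ≤ Δ.Jh := le_sup_left.trans le_sup_left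

lemma J₂_le_Jh : Δ.J₂ ≤ Δ.Jh := le_sup_right

lemma C_uM_mem_Jh (c : Δ.C) : (c.1 Δ.uM : J) ∈ Δ.Jh :=
  (le_sup_right.trans le_sup_left : _ ≤ Δ.Jh) ⟨_, ⟨c, c.2, rfl⟩, rfl⟩

lemma u_mem_Jh : Δ.u ∈ Δ.Jh := C_uM_mem_Jh 1

/-- The triangle `(u; e₁, e₂)` of `J_h`. -/
def triangleJh (h : T.IsSubsystem Δ.Jh) : (T.restrict Δ.Jh h).Triangle where
  u := ⟨Δ.u, u_mem_Jh⟩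
  e₁ := ⟨Δ.e₁, J₁_le_Jh Δ.e₁_mem_J₁⟩
  e₂ := ⟨Δ.e₂, J₂_le_Jh Δ.e₂_mem_J₂⟩
  u_ne_zero h0 := Δ.u_ne_zero (congrArg Subtype.val h0)
  e₁_ne_zero h0 := Δ.e₁_ne_zero (congrArg Subtype.val h0)
  e₂_ne_zero h0 := Δ.e₂_ne_zero (congrArg Subtype.val h0)
  u_tripotent := Subtype.ext Δ.u_tripotent
  e₁_tripotent := Subtype.ext Δ.e₁_tripotent
  e₂_tripotent := Subtype.ext Δ.e₂_tripotent
  e₁_mem_zero := (mem_peirce₀ _ _ _).2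
    ⟨Subtype.ext ((mem_peirce₀ _ _ _).1 Δ.e₁_mem_zero).1,
      Subtype.ext ((mem_peirce₀ _ _ _).1 Δ.e₁_mem_zero).2⟩
  e₂_mem_zero := (mem_peirce₀ _ _ _).2
    ⟨Subtype.ext ((mem_peirce₀ _ _ _).1 Δ.e₂_mem_zero).1,
      Subtype.ext ((mem_peirce₀ _ _ _).1 Δ.e₂_mem_zero).2⟩
  e₁_mem_two := ⟨⟨Δ.e₂, J₂_le_Jh Δ.e₂_mem_J₂⟩, Subtype.ext Δ.P_u_e₂⟩
  e₂_mem_two := ⟨⟨Δ.e₁, J₁_le_Jh Δ.e₁_mem_J₁⟩, Subtype.ext Δ.P_u_e₁⟩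
  u_mem_one₁ := (mem_peirce₁ _ _ _).2 (Subtype.ext ((mem_peirce₁ _ _ _).1 Δ.u_mem_one₁))
  u_mem_one₂ := (mem_peirce₁ _ _ _).2 (Subtype.ext ((mem_peirce₁ _ _ _).1 Δ.u_mem_one₂))
  P_u_e₁ := Subtype.ext Δ.P_u_e₁
  P_u_e₂ := Subtype.ext Δ.P_u_e₂
  tri_e₁_u_e₂ := Subtype.ext Δ.tri_e₁_u_e₂

lemma mem_J₁_triangleJh (h : T.IsSubsystem Δ.Jh) (x : Δ.Jh) :
    x ∈ (triangleJh h).J₁ ↔ (x : J) ∈ Δ.J₁ := by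
  constructor
  · rintro ⟨y, rfl⟩
    exact ⟨y, rfl⟩
  · intro hx
    exact ⟨⟨T.P Δ.e₁ x, J₁_le_Jh ⟨_, rfl⟩⟩, Subtype.ext (Δ.P_e₁_P_e₁ hx)⟩

lemma mem_J₂_triangleJh (h : T.IsSubsystem Δ.Jh) (x : Δ.Jh) :
    x ∈ (triangleJh h).J₂ ↔ (x : J) ∈ Δ.J₂ := by
  constructor
  · rintro ⟨y, rfl⟩
    exact ⟨y, rfl⟩
  · intro hx
    exact ⟨⟨T.P Δ.e₂ x, J₂_le_Jh ⟨_, rfl⟩⟩, Subtype.ext (Δ.swap.P_e₁_P_e₁ hx)⟩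

lemma mem_M_triangleJh (h : T.IsSubsystem Δ.Jh) (x : Δ.Jh) :
    x ∈ (triangleJh h).M ↔ (x : J) ∈ Δ.M := by
  change x ∈ (T.restrict Δ.Jh h).peirce₁ _ ∧ x ∈ (T.restrict Δ.Jh h).peirce₁ _ ↔
    (x : J) ∈ T.peirce₁ _ ∧ (x : J) ∈ T.peirce₁ _
  simp only [mem_peirce₁]
  exact and_congr Subtype.ext_iff Subtype.ext_iff

lemma isGradedTriangulating_triangleJh (hΔ : Δ.IsGradedTriangulating G)
    (h : T.IsSubsystem Δ.Jh) :
    (triangleJh h).IsGradedTriangulating (inducedGrading G Δ.Jh) where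
  isGrading := hΔ.1.restrict h (isGradedSubmodule_Jh hΔ)
  isTriangulating := by
    refine .of_exists_eq (fun x => ?_) (fun x₁ h1 m hm x₂ h2 h0 => ?_)
    · obtain ⟨x₁, c, x₂, rfl⟩ := exists_mkJh_eq x
      exact ⟨⟨x₁, J₁_le_Jh x₁.2⟩, (mem_J₁_triangleJh h _).2 x₁.2,
        ⟨_, C_uM_mem_Jh c⟩, (mem_M_triangleJh h _).2 (c.1 Δ.uM).2,
        ⟨x₂, J₂_le_Jh x₂.2⟩, (mem_J₂_triangleJh h _).2 x₂.2, rfl⟩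
    · rw [mem_J₁_triangleJh] at h1
      rw [mem_M_triangleJh] at hm
      rw [mem_J₂_triangleJh] at h2
      obtain ⟨a, b, c⟩ := hΔ.2.eq_zero h1 hm h2 (congrArg Subtype.val h0)
      exact ⟨Subtype.ext a, Subtype.ext b, Subtype.ext c⟩
  u_mem := hΔ.u_mem
  e₁_mem := hΔ.e₁_mem
  e₂_mem := hΔ.e₂_mem

lemma Jh_eq_top_iff (h : Δ.IsTriangulating) : Δ.Jh = ⊤ ↔ Δ.Cu = ⊤ := by
  constructor
  · intro ht
    rw [eq_top_iff]
    rintro m -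
    obtain ⟨x₁, c, x₂, e⟩ := exists_mkJh_eq (⟨m, ht ▸ Submodule.mem_top⟩ : Δ.Jh)
    have e' : (0 : J) + m + 0 = x₁ + (c.1 Δ.uM : Δ.M) + x₂ := by
      rw [zero_add, add_zero]; exact congrArg Subtype.val e
    obtain ⟨-, hm, -⟩ := h.eq_of_eq Δ.J₁.zero_mem m.2 Δ.J₂.zero_mem x₁.2 (c.1 Δ.uM).2 x₂.2 e'
    exact ⟨c, c.2, Subtype.ext hm.symm⟩
  · intro ht
    rw [eq_top_iff]
    rintro x -
    obtain ⟨x₁, h1, m, hm, x₂, h2, rfl⟩ := h.exists_eq x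
    refine add_mem (add_mem (J₁_le_Jh h1) ?_) (J₂_le_Jh h2)
    exact (le_sup_right.trans le_sup_left : _ ≤ Δ.Jh) ⟨⟨m, hm⟩, ht ▸ Submodule.mem_top, rfl⟩

end Triangle

end JordanTripleSystem

/-! ### Hermitian matrices -/

section Matrix

lemma fin_two_map {R S : Type*} (f : R → S) (a b c d : R) :
    !![a, b; c, d].map f = !![f a, f b; f c, f d] := by
  ext i j
  fin_cases i <;> fin_cases j <;> rfl

lemma fin_two_congr {R : Type*} {a b c d a' b' c' d' : R} (ha : a = a') (hb : b = b')
    (hc : c = c') (hd : d = d') : !![a, b; c, d] = !![a', b'; c', d'] := by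
  rw [ha, hb, hc, hd]

lemma fin_two_mul_mul {R : Type*} [Semiring R] (x a b z y c d w : R) :
    !![x, a; b, z] * !![y, c; d, w] * !![x, a; b, z] =
      !![x * y * x + x * c * b + a * d * x + a * w * b,
        x * y * a + a * d * a + x * c * z + a * w * z;
        b * y * x + b * c * b + z * d * x + z * w * b,
        z * w * z + z * d * a + b * c * z + b * y * a] := by
  ext i j
  fin_cases i <;> fin_cases j <;> simp [Matrix.mul_apply, add_mul] <;> abel

end Matrix

namespace CoordinateSystem

variable {k A Λ : Type*} [CommRing k] [Ring A] [Algebra k A] [AddCommGroup Λ]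

/-- The grading of a coordinate system grades the hermitian matrix system, as soon as the
homogeneous matrices span. -/
lemma IsGraded.isGrading_hermitianSystem {X : CoordinateSystem k A} {𝒜 : Λ → Submodule k A}
    (h : X.IsGraded 𝒜) (hsup : ⨆ i, X.gradedH₂ 𝒜 i = ⊤) :
    X.hermitianSystem.IsGrading (X.gradedH₂ 𝒜) := by
  have := h.gradedMonoid
  have hbar : ∀ {i} {Y : X.H₂}, Y ∈ X.gradedH₂ 𝒜 i → ∀ r s, X.bar (Y.1 r s) ∈ 𝒜 i :=
    fun hY r s => h.bar_mem _ _ (hY r s)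
  refine ⟨⟨?_, hsup⟩, fun i j Y hY Z hZ r s => ?_, fun i j l Y hY Z hZ W hW r s => ?_⟩
  · have hA := h.directSum.1
    rw [iSupIndep_iff_finsetSum_eq_zero_imp_eq_zero] at hA ⊢
    intro t v hv h0 i hi
    apply Subtype.ext
    ext r s
    refine hA t (fun i => (v i).1 r s) (fun i hi => hv i hi r s) ?_ i hi
    have := congrArg (fun Y : X.H₂ => Y.1 r s) h0
    simpa [Matrix.sum_apply] using this
  · change (Y.1 * Z.1.map X.bar * Y.1) r s ∈ 𝒜 (i + i + j)
    rw [add_right_comm]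
    simp only [Matrix.mul_apply, Matrix.map_apply]
    exact sum_mem fun _ _ => SetLike.mul_mem_graded
      (sum_mem fun _ _ => SetLike.mul_mem_graded (hY _ _) (hbar hZ _ _)) (hY _ _)
  · change tripleOf (JordanTripleSystem.assocP X.bar.mapMatrix) Y.1 Z.1 W.1 r s ∈ 𝒜 (i + j + l)
    rw [JordanTripleSystem.tripleOf_assocP, Matrix.add_apply]
    simp only [Matrix.mul_apply, AlgHom.mapMatrix_apply, Matrix.map_apply]
    refine add_mem (sum_mem fun _ _ => SetLike.mul_mem_graded
      (sum_mem fun _ _ => SetLike.mul_mem_graded (hY _ _) (hbar hZ _ _)) (hW _ _)) ?_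
    rw [show i + j + l = l + j + i by abel]
    exact sum_mem fun _ _ => SetLike.mul_mem_graded
      (sum_mem fun _ _ => SetLike.mul_mem_graded (hW _ _) (hbar hZ _ _)) (hY _ _)

end CoordinateSystem

/-! ### The coordinate system on `C|_{Cu}` -/

namespace JordanTripleSystem

namespace Triangle

variable {k J Λ : Type*} [CommRing k] [AddCommGroup J] [Module k J] [AddCommGroup Λ]
  {T : JordanTripleSystem k J} {Δ : T.Triangle} {G : Λ → Submodule k J}

/-- `u` as an element of `Cu`. -/
def uCu (Δ : T.Triangle) : Δ.Cu := ⟨Δ.uM, ⟨1, Δ.C.one_mem, rfl⟩⟩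

/-- Evaluation `a ↦ au` at `u`, as a map from `A` to `J`. -/
def evalA (Δ : T.Triangle) : Δ.A →ₗ[k] J :=
  Δ.M.subtype ∘ₗ Δ.Cu.subtype ∘ₗ (LinearMap.applyₗ Δ.uCu : Module.End k Δ.Cu →ₗ[k] Δ.Cu) ∘ₗ
    Δ.A.val.toLinearMap

lemma toA_surjective : Function.Surjective Δ.toA := Δ.resCu.rangeRestrict_surjective

/-- An element of `C` acts on `Cu` as determined by its value at `u`, since `Cu = (τCτ)u` and
`C` commutes with `τCτ`. -/
lemma toA_eq_of_uM (h : Δ.IsTriangulating) {c d : Δ.C} (hcd : c.1 Δ.uM = d.1 Δ.uM) :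
    Δ.toA c = Δ.toA d := by
  -- `c(bu) = τ b^π τ (cu)`
  have key : ∀ c b : Δ.C, c.1 (b.1 Δ.uM) = τM h ((rev h b).1 (τM h (c.1 Δ.uM))) := fun c b => by
    have := conj_comm h c (rev h b) Δ.uM
    rwa [conj_uM, rev_rev] at this
  apply Subtype.ext
  ext z : 1
  apply Subtype.ext
  obtain ⟨_, ⟨b, hb, rfl⟩⟩ := z
  change c.1 ((⟨b, hb⟩ : Δ.C).1 Δ.uM) = d.1 ((⟨b, hb⟩ : Δ.C).1 Δ.uM)
  rw [key, key, hcd]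

lemma evalA_injective (h : Δ.IsTriangulating) : Function.Injective Δ.evalA := by
  intro a b hab
  obtain ⟨c, rfl⟩ := toA_surjective a
  obtain ⟨d, rfl⟩ := toA_surjective b
  exact toA_eq_of_uM h (Subtype.ext hab)

/-- The involution of `A` induced by the reversal involution of `C`. It is defined as
`a ↦ L(t(au))|_{Cu} - a`, which depends on `a` only. -/
def revA (h : Δ.IsTriangulating) : Δ.A →ₗ[k] Δ.A :=
  Δ.toA.toLinearMap ∘ₗ Δ.LC ∘ₗ trace h ∘ₗ Δ.Cu.subtype ∘ₗ
    (LinearMap.applyₗ Δ.uCu : Module.End k Δ.Cu →ₗ[k] Δ.Cu) ∘ₗ Δ.A.val.toLinearMap - LinearMap.id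

lemma revA_toA (h : Δ.IsTriangulating) (c : Δ.C) : revA h (Δ.toA c) = Δ.toA (rev h c) := by
  have : revA h (Δ.toA c) = Δ.toA (Δ.LC (trace h (c.1 Δ.uM))) - Δ.toA c := rfl
  rw [this, LC_trace, map_add, add_sub_cancel_left]

lemma barM_mem_Cu (h : Δ.IsTriangulating) {m : Δ.M} (hm : m ∈ Δ.Cu) : Δ.barM m ∈ Δ.Cu := by
  obtain ⟨c, hc, rfl⟩ := hm
  exact ⟨_, (barC h ⟨c, hc⟩).2, barC_uM h ⟨c, hc⟩⟩

/-- The automorphism `a ↦ P(e)aP(e)` of `End(Cu)`. -/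
def barEndCu (h : Δ.IsTriangulating) : Module.End k Δ.Cu ≃ₐ[k] Module.End k Δ.Cu :=
  (LinearEquiv.ofInvolutive (Δ.barM.restrict fun _ hm => barM_mem_Cu h hm)
    fun m => Subtype.ext (barM_barM h m)).conjAlgEquiv k

/-- The automorphism `a ↦ P(e)aP(e)` of `A`. -/
def barA (h : Δ.IsTriangulating) : Δ.A →ₐ[k] Δ.A :=
  ((barEndCu h).toAlgHom.comp Δ.A.val).codRestrict Δ.A fun a => by
    obtain ⟨c, rfl⟩ := toA_surjective a
    exact (Δ.toA (barC h c)).2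

lemma barA_toA (h : Δ.IsTriangulating) (c : Δ.C) : barA h (Δ.toA c) = Δ.toA (barC h c) := rfl

lemma toA_LC_mem (x : Δ.J₁) : Δ.toA (Δ.LC x) ∈ Δ.A₀ := ⟨x, rfl⟩

/-- The coordinate system of a triangulated Jordan triple system. -/
def coordinateSystem (h : Δ.IsTriangulating) : CoordinateSystem k Δ.A where
  π := revA h
  π_mul a b := by
    obtain ⟨c, rfl⟩ := toA_surjective a
    obtain ⟨d, rfl⟩ := toA_surjective b
    rw [← map_mul, revA_toA, revA_toA, revA_toA, rev_mul, map_mul]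
  π_π a := by
    obtain ⟨c, rfl⟩ := toA_surjective a
    rw [revA_toA, revA_toA, rev_rev]
  bar := barA h
  bar_bar a := by
    obtain ⟨c, rfl⟩ := toA_surjective a
    rw [barA_toA, barA_toA, barC_barC]
  bar_π a := by
    obtain ⟨c, rfl⟩ := toA_surjective a
    rw [barA_toA, revA_toA, revA_toA, barA_toA, rev_barC]
  A₀ := Δ.A₀
  bar_mem a ha := by
    obtain ⟨x, rfl⟩ := ha
    change barA h (Δ.toA (Δ.LC x)) ∈ Δ.A₀
    rw [barA_toA, barC_LC]
    exact toA_LC_mem _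
  π_eq a ha := by
    obtain ⟨x, rfl⟩ := ha
    change revA h (Δ.toA (Δ.LC x)) = Δ.toA (Δ.LC x)
    rw [revA_toA, rev_LC]
  one_mem := by
    rw [← map_one Δ.toA, ← LC_e₁]
    exact toA_LC_mem _
  ample a b hb := by
    obtain ⟨c, rfl⟩ := toA_surjective a
    obtain ⟨x, rfl⟩ := hb
    change Δ.toA c * Δ.toA (Δ.LC x) * revA h (Δ.toA c) ∈ Δ.A₀
    have := LC_PM h c (τ₁ (Δ.bar₁ x))
    rw [star_τ₁ h, bar₁_bar₁ h] at this
    rw [revA_toA, ← map_mul, ← map_mul, ← this]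
    exact toA_LC_mem _

lemma evalA_mem (hΔ : Δ.IsGradedTriangulating G) (i : Λ) (a : Δ.A) (ha : a ∈ Δ.gradedA G i) :
    Δ.evalA a ∈ G i := by
  obtain ⟨c, hc, rfl⟩ := ha
  exact uM_mem_of_mem_gradedC hΔ hc

lemma toA_mem_gradedA {i : Λ} {c : Δ.C} (hc : c ∈ Δ.gradedC G i) : Δ.toA c ∈ Δ.gradedA G i :=
  ⟨c, hc, rfl⟩

lemma iSup_gradedA (hΔ : Δ.IsGradedTriangulating G) : ⨆ i, Δ.gradedA G i = ⊤ := by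
  have : ⨆ i, Δ.gradedA G i = (⨆ i, Δ.gradedC G i).map Δ.toA.toLinearMap :=
    (Submodule.map_iSup _ _).symm
  rw [this, iSup_gradedC hΔ, Submodule.map_top, LinearMap.range_eq_top]
  exact toA_surjective

lemma isGraded_coordinateSystem (hΔ : Δ.IsGradedTriangulating G) :
    (coordinateSystem hΔ.2).IsGraded (Δ.gradedA G) where
  directSum := ⟨hΔ.1.directSum.1.of_injective Δ.evalA (evalA_injective hΔ.2) (evalA_mem hΔ),
    iSup_gradedA hΔ⟩
  gradedMonoid :=
    { one_mem := ⟨1, one_mem_gradedC, map_one Δ.toA⟩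
      mul_mem := by
        rintro i j _ _ ⟨c, hc, rfl⟩ ⟨d, hd, rfl⟩
        exact ⟨c * d, mul_mem_gradedC hc hd, map_mul Δ.toA c d⟩ }
  π_mem := by
    rintro i _ ⟨c, hc, rfl⟩
    exact ⟨_, rev_mem_gradedC hΔ hc, (revA_toA hΔ.2 c).symm⟩
  bar_mem := by
    rintro i _ ⟨c, hc, rfl⟩
    exact ⟨_, barC_mem_gradedC hΔ hc, rfl⟩
  A₀_graded := isGradedSubmodule_range (isGradedSubmodule_J₁ hΔ).iSup_inducedGrading _
    fun i _ hx => toA_mem_gradedA (LC_mem_gradedC hΔ i hx)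

lemma isDiagonal_coordinateSystem (h : Δ.IsTriangulating) : (coordinateSystem h).IsDiagonal := by
  rw [CoordinateSystem.IsDiagonal, eq_top_iff]
  rintro a -
  obtain ⟨c, rfl⟩ := toA_surjective a
  induction c using C_induction with
  | word l =>
    rw [map_list_prod]
    refine Subalgebra.list_prod_mem _ ?_
    intro y hy
    simp only [List.map_map, List.mem_map] at hy
    obtain ⟨x, -, rfl⟩ := hy
    exact Algebra.subset_adjoin (toA_LC_mem x)
  | add c d hc hd => rw [map_add]; exact add_mem hc hd
  | smul a c hc => rw [map_smul]; exact Subalgebra.smul_mem _ hc a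

/-! ### The isomorphism with the hermitian matrix system -/

lemma evalA_mem_M (a : Δ.A) : Δ.evalA a ∈ Δ.M := by
  obtain ⟨c, rfl⟩ := toA_surjective a
  exact (c.1 Δ.uM).2

/-- The map `J₁ × A × J₂ → J`, `(x₁, a, x₂) ↦ x₁ + au + x₂`. -/
def ofTriple (Δ : T.Triangle) : (Δ.J₁ × Δ.A × Δ.J₂) →ₗ[k] J :=
  Δ.J₁.subtype.coprod (Δ.evalA.coprod Δ.J₂.subtype)

lemma ofTriple_apply (x : Δ.J₁) (a : Δ.A) (z : Δ.J₂) :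
    Δ.ofTriple (x, a, z) = x + Δ.evalA a + z := by
  rw [add_assoc]; rfl

lemma ofTriple_injective (h : Δ.IsTriangulating) : Function.Injective Δ.ofTriple := by
  rintro ⟨x, a, z⟩ ⟨y, b, w⟩ hxy
  rw [ofTriple_apply, ofTriple_apply] at hxy
  obtain ⟨h1, h2, h3⟩ := h.eq_of_eq x.2 (evalA_mem_M a) z.2 y.2 (evalA_mem_M b) w.2 hxy
  rw [Subtype.ext h1, evalA_injective h h2, Subtype.ext h3]

lemma range_ofTriple : LinearMap.range Δ.ofTriple = Δ.Jh := by
  ext v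
  constructor
  · rintro ⟨⟨x, a, z⟩, rfl⟩
    obtain ⟨c, rfl⟩ := toA_surjective a
    rw [ofTriple_apply]
    exact Δ.mem_Jh x c z
  · intro hv
    obtain ⟨x, c, z, e⟩ := exists_mkJh_eq ⟨v, hv⟩
    exact ⟨(x, Δ.toA c, z), (ofTriple_apply _ _ _).trans (congrArg Subtype.val e).symm⟩

/-- The isomorphism `J₁ × A × J₂ ≃ J_h`, `(x₁, a, x₂) ↦ x₁ + au + x₂`. -/
noncomputable def tripleEquiv (h : Δ.IsTriangulating) : (Δ.J₁ × Δ.A × Δ.J₂) ≃ₗ[k] Δ.Jh :=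
  (LinearEquiv.ofInjective Δ.ofTriple (ofTriple_injective h)).trans
    (LinearEquiv.ofEq _ _ range_ofTriple)

lemma tripleEquiv_apply (h : Δ.IsTriangulating) (x : Δ.J₁) (c : Δ.C) (z : Δ.J₂) :
    tripleEquiv h (x, Δ.toA c, z) = Δ.mkJh x c z :=
  Subtype.ext (ofTriple_apply _ _ _)

/-- The map `x₂ ↦ x₂*`, as a linear map. -/
def starₗ (Δ : T.Triangle) : Δ.J₂ →ₗ[k] Δ.J₁ := Δ.τ.restrict fun _ hx => Δ.star_mem_J₁ hx

/-- The hermitian matrix with entries `L(x₁)`, `a`, `L(x₂*)`. -/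
def toMatrix (h : Δ.IsTriangulating) :
    (Δ.J₁ × Δ.A × Δ.J₂) →ₗ[k] (coordinateSystem h).H₂ where
  toFun v := ⟨!![Δ.toA (Δ.LC v.1), v.2.1; revA h v.2.1, Δ.toA (Δ.LC (Δ.star v.2.2))], by
    have hπ : ∀ x, Δ.toA (Δ.LC x) = (coordinateSystem h).π (Δ.toA (Δ.LC x)) := fun x =>
      ((coordinateSystem h).π_eq _ (toA_LC_mem x)).symm
    refine ⟨fun i j => ?_, fun i => ?_⟩
    · fin_cases i <;> fin_cases j
      · exact hπ _
      · exact ((coordinateSystem h).π_π _).symm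
      · rfl
      · exact hπ _
    · fin_cases i
      · exact toA_LC_mem _
      · exact toA_LC_mem _⟩
  map_add' v w := by
    have : Δ.star (v.2.2 + w.2.2) = Δ.star v.2.2 + Δ.star w.2.2 := Δ.starₗ.map_add _ _
    apply Subtype.ext
    ext i j : 2
    fin_cases i <;> fin_cases j <;> simp [this]
  map_smul' a v := by
    have : Δ.star (a • v.2.2) = a • Δ.star v.2.2 := Δ.starₗ.map_smul _ _
    apply Subtype.ext
    ext i j : 2
    fin_cases i <;> fin_cases j <;> simp [this]

lemma coe_toMatrix (h : Δ.IsTriangulating) (x : Δ.J₁) (c : Δ.C) (z : Δ.J₂) :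
    (toMatrix h (x, Δ.toA c, z) : Matrix (Fin 2) (Fin 2) Δ.A) =
      !![Δ.toA (Δ.LC x), Δ.toA c; Δ.toA (rev h c), Δ.toA (Δ.LC (Δ.star z))] := by
  rw [← revA_toA]; rfl

/-- Faithfulness says that `x ↦ L(x)|_{Cu}` is injective already after evaluation at `u`. -/
lemma toA_LC_injective (hu : Δ.IsFaithful) {x y : Δ.J₁}
    (hxy : Δ.toA (Δ.LC x) = Δ.toA (Δ.LC y)) : x = y := by
  have h1 : T.tri (x : J) Δ.e₁ Δ.u = T.tri (y : J) Δ.e₁ Δ.u := congrArg Δ.evalA hxy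
  have h2 : T.tri ((x - y : Δ.J₁) : J) Δ.e₁ Δ.u = 0 := by
    have := T.tri_add_left (x - y : Δ.J₁) y Δ.e₁ Δ.u
    rw [← Submodule.coe_add, sub_add_cancel, h1] at this
    exact left_eq_add.1 (this.trans (add_comm _ _))
  exact sub_eq_zero.1 (Subtype.ext (hu _ (x - y).2 h2))

lemma toMatrix_bijective (h : Δ.IsTriangulating) (hu : Δ.IsFaithful) :
    Function.Bijective (toMatrix h) := by
  constructor
  · rintro ⟨x, a, z⟩ ⟨y, b, w⟩ e
    have e' := fun i j => congrArg (fun Y : (coordinateSystem h).H₂ => Y.1 i j) e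
    have h1 : x = y := toA_LC_injective hu (e' 0 0)
    have h2 : a = b := e' 0 1
    have h3 : Δ.star z = Δ.star w := toA_LC_injective hu (e' 1 1)
    have h4 : (z : J) = w := by
      rw [← h.τ_τ z, ← h.τ_τ w]
      exact congrArg Δ.τ (congrArg Subtype.val h3)
    rw [h1, h2, Subtype.ext h4]
  · rintro ⟨Y, hY⟩
    obtain ⟨x, hx⟩ := hY.2 0
    obtain ⟨z, hz⟩ := hY.2 1
    refine ⟨(x, Y 0 1, τ₁ z), Subtype.ext (Matrix.ext fun i j => ?_)⟩
    fin_cases i <;> fin_cases j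
    · exact hx
    · rfl
    · exact (hY.1 1 0).symm
    · change Δ.toA (Δ.LC (Δ.star (τ₁ z))) = _
      rw [star_τ₁ h]
      exact hz

/-- The isomorphism `J_h ≃ H₂(A, A₀, π, ¯)`. -/
noncomputable def hermitianEquiv (h : Δ.IsTriangulating) (hu : Δ.IsFaithful) :
    Δ.Jh ≃ₗ[k] (coordinateSystem h).H₂ :=
  (tripleEquiv h).symm.trans (LinearEquiv.ofBijective _ (toMatrix_bijective h hu))

lemma hermitianEquiv_mkJh (h : Δ.IsTriangulating) (hu : Δ.IsFaithful) (x : Δ.J₁) (c : Δ.C)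
    (z : Δ.J₂) : hermitianEquiv h hu (Δ.mkJh x c z) = toMatrix h (x, Δ.toA c, z) := by
  rw [hermitianEquiv, LinearEquiv.trans_apply, ← tripleEquiv_apply h, LinearEquiv.symm_apply_apply]
  rfl

/-- The entries of `X Ȳ X` for hermitian matrices `X` and `Y` over `A`. -/
lemma toMatrix_eq_mul_mul (h : Δ.IsTriangulating) {x y p : Δ.J₁} {c d q : Δ.C} {z w r : Δ.J₂}
    (hp : Δ.LC p = Δ.LC x * barC h (Δ.LC y) * Δ.LC x + Δ.LC x * barC h d * rev h c +
      c * rev h (barC h d) * Δ.LC x + c * barC h (Δ.LC (Δ.star w)) * rev h c)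
    (hq : q = Δ.LC x * barC h (Δ.LC y) * c + c * rev h (barC h d) * c +
      Δ.LC x * barC h d * Δ.LC (Δ.star z) + c * barC h (Δ.LC (Δ.star w)) * Δ.LC (Δ.star z))
    (hr : Δ.LC (Δ.star r) = Δ.LC (Δ.star z) * barC h (Δ.LC (Δ.star w)) * Δ.LC (Δ.star z) +
      Δ.LC (Δ.star z) * rev h (barC h d) * c + rev h c * barC h d * Δ.LC (Δ.star z) +
      rev h c * barC h (Δ.LC y) * c) :
    (toMatrix h (p, Δ.toA q, r)).1 = (toMatrix h (x, Δ.toA c, z)).1 *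
      (toMatrix h (y, Δ.toA d, w)).1.map (barA h) * (toMatrix h (x, Δ.toA c, z)).1 := by
  have hrev : rev h q = rev h c * barC h (Δ.LC y) * Δ.LC x + rev h c * barC h d * rev h c +
        Δ.LC (Δ.star z) * rev h (barC h d) * Δ.LC x +
        Δ.LC (Δ.star z) * barC h (Δ.LC (Δ.star w)) * rev h c := by
    rw [hq]
    simp only [map_add, rev_mul, rev_LC, rev_rev, barC_LC, mul_assoc]
  have h1 : (toMatrix h (y, Δ.toA d, w)).1.map (barA h) =
      !![Δ.toA (barC h (Δ.LC y)), Δ.toA (barC h d);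
        Δ.toA (rev h (barC h d)), Δ.toA (barC h (Δ.LC (Δ.star w)))] := by
    rw [coe_toMatrix h y, rev_barC]
    exact fin_two_map _ _ _ _ _
  rw [h1, coe_toMatrix h x, fin_two_mul_mul]
  refine (coe_toMatrix h p q r).trans (fin_two_congr ((congrArg Δ.toA hp).trans ?_)
    ((congrArg Δ.toA hq).trans ?_) ((congrArg Δ.toA hrev).trans ?_)
    ((congrArg Δ.toA hr).trans ?_))
  all_goals simp only [map_add, map_mul]

/-- The matrix of the product of two elements of `J_h`, given by its components, is `X Ȳ X`. -/
lemma toMatrix_P (h : Δ.IsTriangulating) (x : Δ.J₁) (c : Δ.C) (z : Δ.J₂) (y : Δ.J₁)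
    (d : Δ.C) (w : Δ.J₂) :
    (toMatrix h (P₁₁ h x c y d w, Δ.toA (P₁₂ h x c z y d w), P₂₂ h c z y d w)).1 =
      (toMatrix h (x, Δ.toA c, z)).1 * (toMatrix h (y, Δ.toA d, w)).1.map (barA h) *
        (toMatrix h (x, Δ.toA c, z)).1 :=
  toMatrix_eq_mul_mul h (LC_P₁₁ h x c y d w) rfl (LC_star_P₂₂ h c z y d w)

lemma hermitianEquiv_P_mkJh (h : Δ.IsTriangulating) (hu : Δ.IsFaithful)
    (hJ : T.IsSubsystem Δ.Jh) (x : Δ.J₁) (c : Δ.C) (z : Δ.J₂) (y : Δ.J₁) (d : Δ.C) (w : Δ.J₂) :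
    (hermitianEquiv h hu ((T.restrict Δ.Jh hJ).P (Δ.mkJh x c z) (Δ.mkJh y d w))).1 =
      (toMatrix h (x, Δ.toA c, z)).1 * (toMatrix h (y, Δ.toA d, w)).1.map (barA h) *
        (toMatrix h (x, Δ.toA c, z)).1 := by
  have e : (T.restrict Δ.Jh hJ).P (Δ.mkJh x c z) (Δ.mkJh y d w) =
      Δ.mkJh (P₁₁ h x c y d w) (P₁₂ h x c z y d w) (P₂₂ h c z y d w) :=
    Subtype.ext (P_mkJh h x c z y d w)
  have e2 := congrArg Subtype.val ((congrArg (hermitianEquiv h hu) e).trans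
    (hermitianEquiv_mkJh h hu _ _ _))
  exact e2.trans (toMatrix_P h x c z y d w)

lemma hermitianEquiv_map_P (h : Δ.IsTriangulating) (hu : Δ.IsFaithful)
    (hJ : T.IsSubsystem Δ.Jh) (v w : Δ.Jh) :
    hermitianEquiv h hu ((T.restrict Δ.Jh hJ).P v w) =
      (coordinateSystem h).hermitianSystem.P (hermitianEquiv h hu v) (hermitianEquiv h hu w) := by
  refine Exists.elim (exists_mkJh_eq v) fun x ⟨c, z, e⟩ => ?_
  refine Exists.elim (exists_mkJh_eq w) fun y ⟨d, t, e'⟩ => ?_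
  subst e e'
  exact Subtype.ext ((hermitianEquiv_P_mkJh h hu hJ x c z y d t).trans
    (congrArg₂ (fun X Y : (coordinateSystem h).H₂ => X.1 * Y.1.map (barA h) * X.1)
      (hermitianEquiv_mkJh h hu x c z) (hermitianEquiv_mkJh h hu y d t)).symm)

/-- The Peirce components of a homogeneous element are homogeneous. -/
lemma components_mem (hΔ : Δ.IsGradedTriangulating G) {i : Λ} {x m z : J} (hx : x ∈ Δ.J₁)
    (hm : m ∈ Δ.M) (hz : z ∈ Δ.J₂) (hv : x + m + z ∈ G i) : x ∈ G i ∧ m ∈ G i ∧ z ∈ G i := by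
  have z1 : T.P Δ.e₁ m = 0 := Δ.P_e₁_of_mem_M hm
  have z2 : T.P Δ.e₂ m = 0 := Δ.P_e₂_of_mem_M hm
  have z3 : T.P Δ.e₁ z = 0 := Δ.P_e₁_of_mem_J₂ hz
  have z4 : T.P Δ.e₂ x = 0 := Δ.swap.P_e₁_of_mem_J₂ hx
  have h1 : x ∈ G i := by
    have := P_mem_of_mem_zero hΔ.1 hΔ.e₁_mem i (P_mem_of_mem_zero hΔ.1 hΔ.e₁_mem i hv)
    simpa only [map_add, z1, z3, map_zero, add_zero, Δ.P_e₁_P_e₁ hx] using this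
  have h2 : z ∈ G i := by
    have := P_mem_of_mem_zero hΔ.1 hΔ.e₂_mem i (P_mem_of_mem_zero hΔ.1 hΔ.e₂_mem i hv)
    have h3 : T.P Δ.e₂ (T.P Δ.e₂ z) = z := Δ.swap.P_e₁_P_e₁ hz
    simpa only [map_add, z2, z4, map_zero, zero_add, h3] using this
  have h4 := (G i).sub_mem ((G i).sub_mem hv h2) h1
  rw [add_sub_cancel_right, add_sub_cancel_left] at h4
  exact ⟨h1, h4, h2⟩

/-- The degree of an element of `A` can be read off from its value at `u`. -/
lemma toA_mem_gradedA_of_uM_mem (hΔ : Δ.IsGradedTriangulating G) {i : Λ} {c : Δ.C}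
    (hc : (c.1 Δ.uM : J) ∈ G i) : Δ.toA c ∈ Δ.gradedA G i := by
  have h1 : ∀ a : Δ.A, Δ.evalA a ∈ G i → a ∈ Δ.gradedA G i := fun a ha =>
    mem_of_injective_of_mem hΔ.1.directSum.1 (iSup_gradedA hΔ) Δ.evalA (evalA_injective hΔ.2)
      (evalA_mem hΔ) ha
  exact h1 _ hc

lemma toMatrix_mem (hΔ : Δ.IsGradedTriangulating G) {i : Λ} {x : Δ.J₁} {a : Δ.A} {z : Δ.J₂}
    (hx : (x : J) ∈ G i) (ha : a ∈ Δ.gradedA G i) (hz : (z : J) ∈ G i) :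
    toMatrix hΔ.2 (x, a, z) ∈ (coordinateSystem hΔ.2).gradedH₂ (Δ.gradedA G) i := by
  have h1 : Δ.toA (Δ.LC x) ∈ Δ.gradedA G i := toA_mem_gradedA (LC_mem_gradedC hΔ i hx)
  have h2 : revA hΔ.2 a ∈ Δ.gradedA G i := (isGraded_coordinateSystem hΔ).π_mem i _ ha
  have h3 : Δ.toA (Δ.LC (Δ.star z)) ∈ Δ.gradedA G i :=
    toA_mem_gradedA (LC_mem_gradedC hΔ i (τ_mem hΔ i hz))
  intro r s
  fin_cases r <;> fin_cases s
  exacts [h1, ha, h2, h3]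

lemma hermitianEquiv_mem (hΔ : Δ.IsGradedTriangulating G) (hu : Δ.IsFaithful) (i : Λ)
    (v : Δ.Jh) (hv : v ∈ inducedGrading G Δ.Jh i) :
    hermitianEquiv hΔ.2 hu v ∈ (coordinateSystem hΔ.2).gradedH₂ (Δ.gradedA G) i := by
  refine Exists.elim (exists_mkJh_eq v) fun x ⟨c, z, e⟩ => ?_
  have h1 := (congrArg (hermitianEquiv hΔ.2 hu) e).trans (hermitianEquiv_mkJh hΔ.2 hu x c z)
  rw [h1]
  rw [e] at hv
  obtain ⟨hx, hc, hz⟩ := components_mem hΔ x.2 (c.1 Δ.uM).2 z.2 hv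
  exact toMatrix_mem hΔ hx (toA_mem_gradedA_of_uM_mem hΔ hc) hz

lemma coe_hermitianEquiv_mkJh (h : Δ.IsTriangulating) (hu : Δ.IsFaithful) (x : Δ.J₁) (c : Δ.C)
    (z : Δ.J₂) : (hermitianEquiv h hu (Δ.mkJh x c z) : Matrix (Fin 2) (Fin 2) Δ.A) =
      !![Δ.toA (Δ.LC x), Δ.toA c; Δ.toA (rev h c), Δ.toA (Δ.LC (Δ.star z))] :=
  (congrArg Subtype.val (hermitianEquiv_mkJh h hu x c z)).trans (coe_toMatrix h x c z)

lemma star_zero : Δ.star 0 = 0 := Δ.starₗ.map_zero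

lemma toA_LC_zero : Δ.toA (Δ.LC 0) = 0 := by rw [map_zero, map_zero]

lemma toA_LC_star_zero : Δ.toA (Δ.LC (Δ.star 0)) = 0 := by rw [star_zero, toA_LC_zero]

lemma toA_LC_e₁ : Δ.toA (Δ.LC ⟨Δ.e₁, Δ.e₁_mem_J₁⟩) = 1 := by rw [LC_e₁, map_one]

lemma toA_rev_zero (h : Δ.IsTriangulating) : Δ.toA (rev h 0) = 0 := by rw [map_zero, map_zero]

lemma hermitianEquiv_u (h : Δ.IsTriangulating) (hu : Δ.IsFaithful) (v : Δ.Jh)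
    (hv : (v : J) = Δ.u) :
    (hermitianEquiv h hu v : Matrix (Fin 2) (Fin 2) Δ.A) = !![0, 1; 1, 0] := by
  have e : v = Δ.mkJh 0 1 0 := Subtype.ext <| by
    rw [hv]
    change Δ.u = 0 + Δ.u + 0
    rw [zero_add, add_zero]
  subst e
  refine (coe_hermitianEquiv_mkJh h hu 0 1 0).trans ?_
  rw [rev_one]
  exact fin_two_congr toA_LC_zero (map_one Δ.toA) (map_one Δ.toA) toA_LC_star_zero

lemma hermitianEquiv_e₁ (h : Δ.IsTriangulating) (hu : Δ.IsFaithful) (v : Δ.Jh)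
    (hv : (v : J) = Δ.e₁) :
    (hermitianEquiv h hu v : Matrix (Fin 2) (Fin 2) Δ.A) = !![1, 0; 0, 0] := by
  have e : v = Δ.mkJh ⟨Δ.e₁, Δ.e₁_mem_J₁⟩ 0 0 := Subtype.ext <| by
    rw [hv]
    change Δ.e₁ = Δ.e₁ + 0 + 0
    rw [add_zero, add_zero]
  subst e
  exact (coe_hermitianEquiv_mkJh h hu _ 0 0).trans
    (fin_two_congr toA_LC_e₁ (map_zero Δ.toA) (toA_rev_zero h) toA_LC_star_zero)

lemma hermitianEquiv_e₂ (h : Δ.IsTriangulating) (hu : Δ.IsFaithful) (v : Δ.Jh)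
    (hv : (v : J) = Δ.e₂) :
    (hermitianEquiv h hu v : Matrix (Fin 2) (Fin 2) Δ.A) = !![0, 0; 0, 1] := by
  have e : v = Δ.mkJh 0 0 ⟨Δ.e₂, Δ.e₂_mem_J₂⟩ := Subtype.ext <| by
    rw [hv]
    change Δ.e₂ = 0 + 0 + Δ.e₂
    rw [add_zero, zero_add]
  have h2 : Δ.star ⟨Δ.e₂, Δ.e₂_mem_J₂⟩ = ⟨Δ.e₁, Δ.e₁_mem_J₁⟩ := Subtype.ext Δ.τ_e₂
  subst e
  refine (coe_hermitianEquiv_mkJh h hu 0 0 _).trans ?_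
  rw [h2]
  exact fin_two_congr toA_LC_zero (map_zero Δ.toA) (toA_rev_zero h) toA_LC_e₁

/-- The homogeneous matrices span, being the images of the homogeneous elements of `J_h`. -/
lemma iSup_gradedH₂ (hΔ : Δ.IsGradedTriangulating G) (hu : Δ.IsFaithful) :
    ⨆ i, (coordinateSystem hΔ.2).gradedH₂ (Δ.gradedA G) i = ⊤ := by
  have h1 : ∀ v : Δ.Jh, hermitianEquiv hΔ.2 hu v ∈
      ⨆ i, (coordinateSystem hΔ.2).gradedH₂ (Δ.gradedA G) i := fun v => by
    have hv : v ∈ ⨆ i, inducedGrading G Δ.Jh i := by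
      rw [(isGradedSubmodule_Jh hΔ).iSup_inducedGrading]
      exact Submodule.mem_top
    induction hv using Submodule.iSup_induction' with
    | mem i v hv => exact Submodule.mem_iSup_of_mem i (hermitianEquiv_mem hΔ hu i v hv)
    | zero => rw [map_zero]; exact Submodule.zero_mem _
    | add v w _ _ hv hw => rw [map_add]; exact Submodule.add_mem _ hv hw
  refine eq_top_iff.2 fun Y _ => ?_
  rw [← (hermitianEquiv hΔ.2 hu).apply_symm_apply Y]
  exact h1 _

end Triangle

end JordanTripleSystem

theorem mainTheorem8 {k J Λ : Type*} [CommRing k] [AddCommGroup J] [Module k J] [AddCommGroup Λ]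
    (T : JordanTripleSystem k J) (G : Λ → Submodule k J) (Δ : T.Triangle)
    (hΔ : Δ.IsGradedTriangulating G) (hu : Δ.IsFaithful) :
    -- `J_h` is a graded subsystem, graded-triangulated by `(u; e₁, e₂)`
    JordanTripleSystem.IsGradedSubmodule G Δ.Jh ∧
    (∃ hJh : T.IsSubsystem Δ.Jh,
      (∃ Δh : (T.restrict Δ.Jh hJh).Triangle,
        (Δh.u : J) = Δ.u ∧ (Δh.e₁ : J) = Δ.e₁ ∧ (Δh.e₂ : J) = Δ.e₂ ∧
        Δh.IsGradedTriangulating (JordanTripleSystem.inducedGrading G Δ.Jh)) ∧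
      -- the reversal involution of `C` and the graded diagonal coordinate system on `C|_{Cu}`
      ∃ (π : Δ.C →ₗ[k] Δ.C) (X : CoordinateSystem k Δ.A),
        Δ.IsReversal π ∧
        (∀ c : Δ.C, X.π (Δ.toA c) = Δ.toA (π c)) ∧
        (∀ (c : Δ.C) (z : Δ.Cu),
          ((X.bar (Δ.toA c) : Module.End k Δ.Cu) z : Δ.M) =
            Δ.barM ((c : Module.End k Δ.M) (Δ.barM z))) ∧
        X.A₀ = Δ.A₀ ∧
        X.IsGraded (Δ.gradedA G) ∧
        X.IsDiagonal ∧
        X.hermitianSystem.IsGrading (X.gradedH₂ (Δ.gradedA G)) ∧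
        -- the graded isomorphism
        ∃ φ : Δ.Jh ≃ₗ[k] X.H₂,
          JordanTripleSystem.IsGradedIso (T.restrict Δ.Jh hJh)
            (JordanTripleSystem.inducedGrading G Δ.Jh) X.hermitianSystem
            (X.gradedH₂ (Δ.gradedA G)) φ ∧
          (∀ (x₁ : Δ.J₁) (c : Δ.C) (x₂ : Δ.J₂),
            (φ (Δ.mkJh x₁ c x₂) : Matrix (Fin 2) (Fin 2) Δ.A) =
              !![Δ.toA (Δ.LC x₁), Δ.toA c; Δ.toA (π c), Δ.toA (Δ.LC (Δ.star x₂))]) ∧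
          -- triangle to standard triangle `(1[12]; 1[11], 1[22])`
          (∀ x : Δ.Jh, (x : J) = Δ.u →
            (φ x : Matrix (Fin 2) (Fin 2) Δ.A) = !![0, 1; 1, 0]) ∧
          (∀ x : Δ.Jh, (x : J) = Δ.e₁ →
            (φ x : Matrix (Fin 2) (Fin 2) Δ.A) = !![1, 0; 0, 0]) ∧
          (∀ x : Δ.Jh, (x : J) = Δ.e₂ →
            (φ x : Matrix (Fin 2) (Fin 2) Δ.A) = !![0, 0; 0, 1])) ∧
    (Δ.Jh = ⊤ ↔ Δ.Cu = ⊤) := by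
  have h := hΔ.isTriangulating
  have hJ := JordanTripleSystem.Triangle.isSubsystem_Jh h
  open JordanTripleSystem.Triangle in
  exact ⟨isGradedSubmodule_Jh hΔ, ⟨hJ,
    ⟨triangleJh hJ, rfl, rfl, rfl, isGradedTriangulating_triangleJh hΔ hJ⟩,
    rev h, coordinateSystem h, isReversal_rev h, revA_toA h, fun _ _ => rfl, rfl,
    isGraded_coordinateSystem hΔ, isDiagonal_coordinateSystem h,
    (isGraded_coordinateSystem hΔ).isGrading_hermitianSystem (iSup_gradedH₂ hΔ hu),
    hermitianEquiv h hu, ⟨hermitianEquiv_map_P h hu hJ, hermitianEquiv_mem hΔ hu⟩,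
    coe_hermitianEquiv_mkJh h hu, hermitianEquiv_u h hu, hermitianEquiv_e₁ h hu,
    hermitianEquiv_e₂ h hu⟩, Jh_eq_top_iff h⟩
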